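/- Let $(M,d)$ be a (nonempty) global NPC space, i.e. a complete metric space in which any $x,y$ have a point $m$ with $d^2(z,m)\le\frac12d^2(z,x)+\frac12d^2(z,y)-\frac14d^2(x,y)$ for all $z\in M$. For $x,y\in M$ and $t\in[0,1]$ let $x\#_ty$ be the point $\gamma(t)$ of the unique minimal geodesic $\gamma:[0,1]\to M$ from $x$ to $y$. Let $\mathcal P^1(M)$ be the set of Borel probability measures $\mu$ on $M$ with $\mu(\operatorname{supp}\mu)=1$ and $\int d(x,y)\,d\mu(y)<\infty$ for some $x$, with the $1$-Wasserstein distance $d_1^W(\mu,\nu)=\inf_\pi\int d(x,y)\,d\pi(x,y)$, the infimum being over all couplings $\pi$ of $\mu$ and $\nu$. Let $\mathcal C_1(M)$ be the set of maps $\beta:\mathcal P^1(M)\to M$ with $\beta(\delta_x)=x$ for all $x\in M$ and $d(\beta(\mu),\beta(\nu))\le d_1^W(\mu,\nu)$ for all $\mu,\nu\in\mathcal P^1(M)$. Let $$\lambda(\mu)=\operatorname*{arg\,min}_{z\in M}\int_M\bigl[d^2(z,x)-d^2(y,x)\bigr]\,d\mu(x)\qquad(\mu\in\mathcal P^1(M)),$$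 independently of $y\in M$. For $\beta\in\mathcal C_1(M)$, $t\in(0,1]$ and $\mu\in\mathcal P^1(M)$ let $\beta_t(\mu)=\Phi_1(t,\beta)(\mu)$ be the unique $x\in M$ with $x=\beta(x\#_t\mu)$, where $x\#_t\mu$ is the image of $\mu$ under $a\mapsto x\#_ta$. Let $(\Omega,\mathcal A,\mathbf P)$ be a probability space and $T:\Omega\to\Omega$ a $\mathbf P$-preserving measurable map. Let $L^1(\Omega;M)$ be the set of strongly measurable $\varphi:\Omega\to M$ with $\int d(x,\varphi(\omega))\,d\mathbf P(\omega)<\infty$ for some $x\in M$, with $\mathbf d_1(\varphi,\psi)=\int d(\varphi(\omega),\psi(\omega))\,d\mathbf P(\omega)$. For $\beta\in\mathcal C_1(M)$ and $\varphi\in L^1(\Omega;M)$ let $E^\beta(\varphi)=\beta(\varphi_*\mathbf P)$ and $$\Gamma_\beta(\varphi)(\omega)=\lim_{n\to\infty}\beta\bigl(\mu_n^\varphi(\omega)\bigr),\qquad \mu_n^\varphi(\omega)=\frac1n\sum_{k=0}^{n-1}\delta_{\varphi(T^k\omega)} .$$ **Corollary.** Let $\beta\in\mathcal C_1(M)$.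 Then the objects above are well defined: minimal geodesics exist and are unique; the minimizer $\lambda(\mu)$ exists and is unique, and $\lambda\in\mathcal C_1(M)$; the fixed point $\beta_t(\mu)$ exists and is unique, and $\beta_t\in\mathcal C_1(M)$ for all $t\in(0,1]$. Moreover, for every $\varphi\in L^1(\Omega;M)$: 1. For each $\alpha\in\{\lambda\}\cup\{\beta_t:t\in(0,1]\}$ the limit $\Gamma_\alpha(\varphi)$ exists a.e. and in $\mathbf d_1$, and belongs to $L^1(\Omega;M)$; the pointwise limits $\Gamma_{\beta_t}(\varphi)(\omega)$, $t\in(0,1]$, exist simultaneously off one null set that does not depend on $t$. 2. As $t\to0^+$, $\mathbf d_1\bigl(\Gamma_{\beta_t}(\varphi),\Gamma_\lambda(\varphi)\bigr)\to0$. 3. For a.e. $\omega$, $d\bigl(\Gamma_{\beta_t}(\varphi)(\omega),\Gamma_\lambda(\varphi)(\omega)\bigr)\to0$ as $t\to0^+$. 4. If $T$ is ergodic, then $\lim_{t\to0^+}E^{\beta_t}(\varphi)=E^\lambda(\varphi)$. -/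

import Mathlib

open MeasureTheory Filter Topology Set
open scoped ENNReal

noncomputable section

/-! ### Global NPC spaces and their geodesics -/

/-- A global NPC space (Hadamard space): a complete metric space in which any two points
`x`, `y` have a point `m` with
`d(z,m)² ≤ d(z,x)²/2 + d(z,y)²/2 - d(x,y)²/4` for all `z`. -/
structure IsGlobalNPC (M : Type*) [MetricSpace M] : Prop where
  complete : CompleteSpace M
  exists_mid : ∀ x y : M, ∃ m : M, ∀ z : M,
    dist z m ^ 2 ≤ dist z x ^ 2 / 2 + dist z y ^ 2 / 2 - dist x y ^ 2 / 4

/-- `γ`, restricted to `[0,1]`, is a minimal geodesic of constant speed from `x` to `y`. -/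
def IsMinimalGeodesic {M : Type*} [MetricSpace M] (x y : M) (γ : ℝ → M) : Prop :=
  γ 0 = x ∧ γ 1 = y ∧
    ∀ s ∈ Icc (0 : ℝ) 1, ∀ t ∈ Icc (0 : ℝ) 1, dist (γ s) (γ t) = |s - t| * dist x y

/-- The point `x #_t y` at parameter `t ∈ [0,1]` on the minimal geodesic from `x` to `y`
(unique in a global NPC space). -/
def geodesicPoint {M : Type*} [MetricSpace M] [Nonempty M] (x y : M) (t : ℝ) : M :=
  Classical.epsilon (fun γ : ℝ → M => IsMinimalGeodesic x y γ) t

/-! ### Integrable probability measures and contractive barycentric maps -/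

/-- The set `𝒫¹(M)` of Borel probability measures that are carried by their support and have
finite first moment. -/
def P1 (M : Type*) [MetricSpace M] [MeasurableSpace M] : Set (Measure M) :=
  {μ | IsProbabilityMeasure μ ∧ μ (μ.support)ᶜ = 0 ∧ ∃ x : M, ∫⁻ y, edist x y ∂μ < ∞}

/-- The `1`-Wasserstein distance, as the infimum of the transport cost over all couplings.
Measures in `𝒫¹(M)` live on closed separable sets; on a product of two such sets the product
σ-algebra is the Borel σ-algebra, so it makes no difference which of the two the couplings
are defined on. -/
def wasserstein1 {M : Type*} [MetricSpace M] [MeasurableSpace M] (μ ν : Measure M) : ℝ≥0∞ :=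
  ⨅ (π : Measure (M × M)) (_ : π.map Prod.fst = μ ∧ π.map Prod.snd = ν),
    ∫⁻ p, edist p.1 p.2 ∂π

/-- `β ∈ 𝒞₁(M)`: `β` is a (`1`-)contractive barycentric map on `𝒫¹(M)`. As usual a map with
domain `𝒫¹(M)` is given by a total function whose values off `𝒫¹(M)` play no role. -/
def IsContractiveBarycentricMap {M : Type*} [MetricSpace M] [MeasurableSpace M]
    (β : Measure M → M) : Prop :=
  (∀ x : M, β (Measure.dirac x) = x) ∧
    ∀ μ ∈ P1 M, ∀ ν ∈ P1 M, edist (β μ) (β ν) ≤ wasserstein1 μ ν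

/-- `z` minimizes `z ↦ ∫ [d(z,x)² - d(y,x)²] dμ(x)` (for every choice of the base point `y`). -/
def IsCanonicalBarycenter {M : Type*} [MetricSpace M] [MeasurableSpace M]
    (μ : Measure M) (z : M) : Prop :=
  ∀ y w : M, ∫ x, (dist z x ^ 2 - dist y x ^ 2) ∂μ ≤ ∫ x, (dist w x ^ 2 - dist y x ^ 2) ∂μ

/-- The canonical barycentric map `λ` of a global NPC space,
`λ(μ) = argmin_z ∫ [d(z,x)² - d(y,x)²] dμ(x)`. -/
def canonicalBarycenter {M : Type*} [MetricSpace M] [MeasurableSpace M] [Nonempty M]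
    (μ : Measure M) : M :=
  Classical.epsilon (fun z : M => IsCanonicalBarycenter μ z)

/-- The measure `x #_t μ`, the image of `μ` under `a ↦ x #_t a`. -/
def geodesicPush {M : Type*} [MetricSpace M] [MeasurableSpace M] [Nonempty M]
    (x : M) (t : ℝ) (μ : Measure M) : Measure M :=
  μ.map (fun a => geodesicPoint x a t)

/-- The semiflow `Φ₁`: for `t ∈ (0,1]`, `Φ₁(t,β)(μ)` is the (unique) solution `x` of
`x = β(x #_t μ)`. -/
def barycenterFlow {M : Type*} [MetricSpace M] [MeasurableSpace M] [Nonempty M]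
    (t : ℝ) (β : Measure M → M) (μ : Measure M) : M :=
  Classical.epsilon (fun x : M => x = β (geodesicPush x t μ))

/-! ### Integrable `M`-valued functions, expectations and ergodic limits -/

/-- `φ ∈ L¹(Ω;M)`. -/
def MemL1 {Ω M : Type*} [MeasurableSpace Ω] [MetricSpace M] (P : Measure Ω) (φ : Ω → M) : Prop :=
  AEStronglyMeasurable φ P ∧ ∃ x : M, ∫⁻ ω, edist x (φ ω) ∂P < ∞

/-- The `L¹`-distance `𝐝₁(φ,ψ) = ∫ d(φ(ω),ψ(ω)) dP(ω)`. -/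
def distL1 {Ω M : Type*} [MeasurableSpace Ω] [MetricSpace M] (P : Measure Ω) (φ ψ : Ω → M) :
    ℝ≥0∞ :=
  ∫⁻ ω, edist (φ ω) (ψ ω) ∂P

/-- The `β`-expectation `E^β(φ) = β(φ_* P)`. -/
def barycentricExpectation {Ω M : Type*} [MeasurableSpace Ω] [MeasurableSpace M]
    (P : Measure Ω) (β : Measure M → M) (φ : Ω → M) : M :=
  β (P.map φ)

/-- The empirical measure `μ_n^φ(ω) = (1/n) ∑_{k<n} δ_{φ(T^k ω)}`, `n ≥ 1`. -/
def empiricalMeasure {Ω M : Type*} [MeasurableSpace M] (T : Ω → Ω) (φ : Ω → M)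
    (n : ℕ) (ω : Ω) : Measure M :=
  (n : ℝ≥0∞)⁻¹ • ∑ k ∈ Finset.range n, Measure.dirac (φ (T^[k] ω))

/-- `g` is an ergodic limit function of `φ` for `β`: `g ∈ L¹(Ω;M)` and `β(μ_n^φ) → g` both
almost everywhere and in `L¹`. -/
def IsErgodicLimit {Ω M : Type*} [MeasurableSpace Ω] [MetricSpace M] [MeasurableSpace M]
    (P : Measure Ω) (T : Ω → Ω) (β : Measure M → M) (φ g : Ω → M) : Prop :=
  MemL1 P g ∧
  (∀ᵐ ω ∂P, Tendsto (fun n : ℕ => β (empiricalMeasure T φ n ω)) atTop (𝓝 (g ω))) ∧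
  Tendsto (fun n : ℕ => distL1 P (fun ω => β (empiricalMeasure T φ n ω)) g) atTop (𝓝 0)

/-- The ergodic limit function `Γ_β(φ)(ω) = lim_n β(μ_n^φ(ω))`. -/
def ergodicLimit {Ω M : Type*} [MetricSpace M] [MeasurableSpace M] [Nonempty M]
    (T : Ω → Ω) (β : Measure M → M) (φ : Ω → M) (ω : Ω) : M :=
  limUnder atTop (fun n : ℕ => β (empiricalMeasure T φ n ω))

end

/-! The proof separates the geometry of `M` from the dynamics of `T`. Geometry: the maps `β_t`
converge to `λ` pointwise on `P1 M`. Let `b = λ(μ)`, let `x = β_t(μ)` and `D = d(b, x)`. Since `x =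
β(x #_t μ)`, `D` is at most the mean of `d(b, x #_t a)`. The NPC inequality, integrated in `a`,
together with the variance inequality at `b`, gives `2D² ≤ t(2R)²` when `μ` lives in a ball of
radius `R` (`sq_dist_canonicalBarycenter_barycenterFlow_le`). All maps involved are 1-Lipschitz for
`wasserstein1`, so truncation extends the convergence to all of `P1 M` (`tendsto_barycenterFlow`).
For `λ` the Lipschitz bound comes from the variance inequality and Reshetnyak's quadruple
comparison, for `β_t` from convexity of the metric. Dynamics: along almost every orbit the empirical
measures are Cauchy for `contractiveDist`, the supremum of `d(α(μ), α(ν))` over all contractive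
barycentric maps `α` (`ae_tendsto_contractiveDist`). For simple functions this is Birkhoff's theorem
for indicators; the general case follows from the maximal inequality and Borel–Cantelli. The
exceptional null set does not involve `α`, hence not `t`. The two halves meet in
`tendsto_ergodicLimit_of_tendsto`: one long but finite orbit segment approximates the limits for all
`α` at once, and on its empirical measure `β_t → λ`. An integrable majorant common to all `α` turns
this into `L¹` convergence. The statement on expectations is the pointwise convergence at the law of
`φ`. -/

/-! ### Geodesics and comparison inequalities in global NPC spaces. -/

section Geometry

variable {M : Type*} [MetricSpace M]

/-- `m` satisfies the NPC inequality for the position `t` between `x` and `y`. -/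
def IsNPCPoint (x y : M) (t : ℝ) (m : M) : Prop :=
  ∀ z : M, dist z m ^ 2 ≤
    (1 - t) * dist z x ^ 2 + t * dist z y ^ 2 - t * (1 - t) * dist x y ^ 2

/-- Put `z = m'` in the NPC inequality and use `(1-s)t² + s(1-t)² - s(1-s) = (t-s)²`. For `s = t`
this is the source of all uniqueness statements about geodesics. -/
lemma IsNPCPoint.dist_le_of {x y m m' : M} {s t : ℝ} (hs : s ∈ Icc (0 : ℝ) 1)
    (hm : IsNPCPoint x y s m) (h0 : dist m' x ≤ t * dist x y)
    (h1 : dist m' y ≤ (1 - t) * dist x y) :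
    dist m' m ≤ |t - s| * dist x y := by
  have h := hm m'
  have h0' : dist m' x ^ 2 ≤ (t * dist x y) ^ 2 := pow_le_pow_left₀ dist_nonneg h0 2
  have h1' : dist m' y ^ 2 ≤ ((1 - t) * dist x y) ^ 2 := pow_le_pow_left₀ dist_nonneg h1 2
  have h2 := mul_le_mul_of_nonneg_left h0' (sub_nonneg.2 hs.2)
  have h3 := mul_le_mul_of_nonneg_left h1' hs.1
  refine abs_le_of_sq_le_sq' ?_ (by positivity) |>.2
  rw [mul_pow, sq_abs]
  linarith

lemma IsNPCPoint.dist_left {x y m : M} {t : ℝ} (ht : t ∈ Icc (0 : ℝ) 1)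
    (hm : IsNPCPoint x y t m) : dist m x ≤ t * dist x y := by
  have := hm.dist_le_of (m' := x) (t := 0) ht (by simp) (by simp)
  rwa [zero_sub, abs_neg, abs_of_nonneg ht.1, dist_comm] at this

lemma IsNPCPoint.dist_right {x y m : M} {t : ℝ} (ht : t ∈ Icc (0 : ℝ) 1)
    (hm : IsNPCPoint x y t m) : dist m y ≤ (1 - t) * dist x y := by
  have := hm.dist_le_of (m' := y) (t := 1) ht (by simp [dist_comm]) (by simp)
  rwa [abs_of_nonneg (sub_nonneg.2 ht.2), dist_comm] at this

lemma IsNPCPoint.dist_le {x y m m' : M} {s t : ℝ} (hs : s ∈ Icc (0 : ℝ) 1)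
    (ht : t ∈ Icc (0 : ℝ) 1) (hm : IsNPCPoint x y s m) (hm' : IsNPCPoint x y t m') :
    dist m m' ≤ |s - t| * dist x y := by
  rw [dist_comm, abs_sub_comm]
  exact hm.dist_le_of hs (hm'.dist_left ht) (hm'.dist_right ht)

/-- A smaller distance would make the path from `x` to `y` through `m` and `m'` shorter than `dist x
y`. -/
lemma IsNPCPoint.dist_eq {x y m m' : M} {s t : ℝ} (hs : s ∈ Icc (0 : ℝ) 1)
    (ht : t ∈ Icc (0 : ℝ) 1) (hm : IsNPCPoint x y s m) (hm' : IsNPCPoint x y t m') :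
    dist m m' = |s - t| * dist x y := by
  refine le_antisymm (hm.dist_le hs ht hm') ?_
  have h1 := hm.dist_left hs
  have h2 := hm.dist_right hs
  have h3 := hm'.dist_left ht
  have h4 := hm'.dist_right ht
  have h5 := dist_triangle4 x m m' y
  have h6 := dist_triangle4 x m' m y
  rw [dist_comm x m] at h5
  rw [dist_comm x m', dist_comm m' m] at h6
  rcases abs_cases (s - t) with ⟨h, -⟩ | ⟨h, -⟩ <;> rw [h] <;> linarith

lemma IsNPCPoint.symm {x y m : M} {t : ℝ} (hm : IsNPCPoint x y t m) :
    IsNPCPoint y x (1 - t) m := by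
  intro z
  have := hm z
  rw [dist_comm y x]
  linarith

namespace IsGlobalNPC

/-- With `a = (s+t)/2`, the mean of `s(1-s)` and `t(1-t)` plus `(s-t)²/4` is exactly `a(1-a)`. The
term `-d(m,m')²/4` needs the exact distance, not just an upper bound. -/
lemma exists_isNPCPoint_midpoint (hM : IsGlobalNPC M) {x y m m' : M} {s t : ℝ}
    (hs : s ∈ Icc (0 : ℝ) 1) (ht : t ∈ Icc (0 : ℝ) 1) (hm : IsNPCPoint x y s m)
    (hm' : IsNPCPoint x y t m') : ∃ p, IsNPCPoint x y ((s + t) / 2) p := by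
  obtain ⟨p, hp⟩ := hM.exists_mid m m'
  refine ⟨p, fun z => ?_⟩
  have h := hp z
  rw [hm.dist_eq hs ht hm', mul_pow, sq_abs] at h
  linarith [hm z, hm' z]

/-- The admissible parameters contain 0 and 1, are stable under midpoints and, by completeness, form
a closed set. Such a set has no gap: the midpoint of the admissible neighbours of a missing `t`
would lie strictly between them. -/
lemma exists_isNPCPoint (hM : IsGlobalNPC M) (x y : M) {t : ℝ} (ht : t ∈ Icc (0 : ℝ) 1) :
    ∃ m, IsNPCPoint x y t m := by
  have := hM.complete
  set S : Set ℝ := {s | s ∈ Icc (0 : ℝ) 1 ∧ ∃ m, IsNPCPoint x y s m} with hS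
  have h0 : (0 : ℝ) ∈ S := ⟨by simp, x, fun z => by simp⟩
  have h1 : (1 : ℝ) ∈ S := ⟨by simp, y, fun z => by simp⟩
  have hclosed : IsClosed S := by
    rw [← isSeqClosed_iff_isClosed]
    intro u a hu hua
    have ha : a ∈ Icc (0 : ℝ) 1 := isClosed_Icc.mem_of_tendsto hua (.of_forall fun n => (hu n).1)
    choose m hm using fun n => (hu n).2
    have hc : CauchySeq m := by
      rw [Metric.cauchySeq_iff']
      intro ε hε
      obtain ⟨N, hN⟩ := Metric.cauchySeq_iff'.1 hua.cauchySeq (ε / (dist x y + 1)) (by positivity)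
      refine ⟨N, fun n hn => ?_⟩
      have h2 := (hm n).dist_le (hu n).1 (hu N).1 (hm N)
      have h3 := hN n hn
      rw [Real.dist_eq, lt_div_iff₀ (by positivity)] at h3
      nlinarith [abs_nonneg (u n - u N)]
    obtain ⟨p, hp⟩ := cauchySeq_tendsto_of_complete hc
    refine ⟨ha, p, fun z => ?_⟩
    refine le_of_tendsto_of_tendsto' ((tendsto_const_nhds.dist hp).pow 2) ?_ (fun n => hm n z)
    exact (((tendsto_const_nhds.sub hua).mul_const _).add (hua.mul_const _)).sub
      ((hua.mul (tendsto_const_nhds.sub hua)).mul_const _)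
  by_contra hcon
  have htS : t ∉ S := fun h => hcon h.2
  set A := S ∩ Iic t
  set B := S ∩ Ici t
  have hA : sSup A ∈ A := (hclosed.inter isClosed_Iic).csSup_mem ⟨0, h0, ht.1⟩
    ⟨t, fun a ha => ha.2⟩
  have hB : sInf B ∈ B := (hclosed.inter isClosed_Ici).csInf_mem ⟨1, h1, ht.2⟩
    ⟨t, fun a ha => ha.2⟩
  have hAt : sSup A < t := lt_of_le_of_ne hA.2 (fun h => htS (h ▸ hA.1))
  have hBt : t < sInf B := lt_of_le_of_ne hB.2 (fun h => htS (h ▸ hB.1))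
  obtain ⟨ma, hma⟩ := hA.1.2
  obtain ⟨mb, hmb⟩ := hB.1.2
  have hmid : (sSup A + sInf B) / 2 ∈ S :=
    ⟨⟨by linarith [hA.1.1.1, hB.1.1.1], by linarith [hA.1.1.2, hB.1.1.2]⟩,
      hM.exists_isNPCPoint_midpoint hA.1.1 hB.1.1 hma hmb⟩
  rcases le_total ((sSup A + sInf B) / 2) t with h | h
  · have := le_csSup (⟨t, fun a ha => ha.2⟩ : BddAbove A) ⟨hmid, h⟩
    linarith
  · have := csInf_le (⟨t, fun a ha => ha.2⟩ : BddBelow B) ⟨hmid, h⟩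
    linarith

lemma exists_isMinimalGeodesic (hM : IsGlobalNPC M) (x y : M) :
    ∃ γ : ℝ → M, IsMinimalGeodesic x y γ ∧ ∀ t ∈ Icc (0 : ℝ) 1, IsNPCPoint x y t (γ t) := by
  have : Nonempty M := ⟨x⟩
  choose! γ hγ using fun (t : ℝ) (ht : t ∈ Icc (0 : ℝ) 1) => hM.exists_isNPCPoint x y ht
  refine ⟨γ, ⟨?_, ?_, fun s hs t ht => (hγ s hs).dist_eq hs ht (hγ t ht)⟩, hγ⟩
  · have := (hγ 0 (by simp)).dist_left (by simp)
    simpa using this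
  · have := (hγ 1 (by simp)).dist_right (by simp)
    simpa using this

lemma isNPCPoint_of_isMinimalGeodesic (hM : IsGlobalNPC M) {x y : M} {γ : ℝ → M}
    (hγ : IsMinimalGeodesic x y γ) {t : ℝ} (ht : t ∈ Icc (0 : ℝ) 1) :
    IsNPCPoint x y t (γ t) := by
  obtain ⟨m, hm⟩ := hM.exists_isNPCPoint x y ht
  have h0 := hγ.2.2 t ht 0 (by simp)
  have h1 := hγ.2.2 t ht 1 (by simp)
  rw [hγ.1, sub_zero, abs_of_nonneg ht.1] at h0
  rw [hγ.2.1, abs_sub_comm, abs_of_nonneg (sub_nonneg.2 ht.2)] at h1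
  have h2 := hm.dist_le_of ht h0.le h1.le
  have : γ t = m := by simpa using h2
  rwa [this]

/-- Pass through the point `m` at parameter `1/(1+s)` from `x` to `q`, estimating `d(y,p)²` by
`(1+s)d(y,m)² + (1+1/s)d(p,m)²`. The negative terms of the two NPC inequalities then add up to
`-d(x,q)²`. -/
lemma quadrilateral_weighted (hM : IsGlobalNPC M) (x y p q : M) {s : ℝ} (hs : 0 < s) :
    dist y p ^ 2 + dist x q ^ 2 ≤
      dist x p ^ 2 + dist y q ^ 2 + s * dist x y ^ 2 + dist p q ^ 2 / s := by
  have ht : 1 / (1 + s) ∈ Icc (0 : ℝ) 1 := ⟨by positivity, by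
    rw [div_le_one (by positivity)]; linarith⟩
  obtain ⟨m, hm⟩ := hM.exists_isNPCPoint x q ht
  have e : 1 - 1 / (1 + s) = s / (1 + s) := by field_simp; ring
  have hp := hm p
  have hy := hm y
  rw [e] at hp hy
  have htri : dist y p ≤ dist y m + dist p m := dist_comm p m ▸ dist_triangle y m p
  have h1 : dist y p ^ 2 ≤ (1 + s) * dist y m ^ 2 + (1 + s) / s * dist p m ^ 2 := by
    have h2 := pow_le_pow_left₀ dist_nonneg htri 2
    have h3 : (1 + s) * dist y m ^ 2 + (1 + s) / s * dist p m ^ 2 - (dist y m + dist p m) ^ 2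
        = (s * dist y m - dist p m) ^ 2 / s := by field_simp; ring
    have : 0 ≤ (s * dist y m - dist p m) ^ 2 / s := by positivity
    linarith
  have h4 := mul_le_mul_of_nonneg_left hy (by positivity : 0 ≤ 1 + s)
  have h5 := mul_le_mul_of_nonneg_left hp (by positivity : 0 ≤ (1 + s) / s)
  have e1 : (1 + s) * (s / (1 + s) * dist y x ^ 2 + 1 / (1 + s) * dist y q ^ 2 -
      1 / (1 + s) * (s / (1 + s)) * dist x q ^ 2) =
      s * dist y x ^ 2 + dist y q ^ 2 - s / (1 + s) * dist x q ^ 2 := by field_simp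
  have e2 : (1 + s) / s * (s / (1 + s) * dist p x ^ 2 + 1 / (1 + s) * dist p q ^ 2 -
      1 / (1 + s) * (s / (1 + s)) * dist x q ^ 2) =
      dist p x ^ 2 + dist p q ^ 2 / s - 1 / (1 + s) * dist x q ^ 2 := by field_simp
  have e3 : s / (1 + s) * dist x q ^ 2 + 1 / (1 + s) * dist x q ^ 2 = dist x q ^ 2 := by
    field_simp; ring
  rw [e1] at h4
  rw [e2] at h5
  rw [dist_comm x p, dist_comm x y]
  linarith

/-- Reshetnyak's quadruple comparison in a global NPC space. -/
theorem quadrilateral (hM : IsGlobalNPC M) (x y p q : M) :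
    dist y p ^ 2 + dist x q ^ 2 ≤
      dist x p ^ 2 + dist y q ^ 2 + 2 * dist x y * dist p q := by
  rcases eq_or_ne x y with rfl | hxy
  · simp
  rcases eq_or_ne p q with rfl | hpq
  · simp [add_comm]
  have h1 := dist_pos.2 hxy
  have h2 := dist_pos.2 hpq
  -- This weight minimizes `s d(x,y)² + d(p,q)²/s`.
  have h := hM.quadrilateral_weighted x y p q (div_pos h2 h1)
  have e : dist p q / dist x y * dist x y ^ 2 + dist p q ^ 2 / (dist p q / dist x y) =
    2 * dist x y * dist p q := by field_simp; ring
  linarith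

variable [Nonempty M]

lemma isMinimalGeodesic_geodesicPoint (hM : IsGlobalNPC M) (x y : M) :
    IsMinimalGeodesic x y (geodesicPoint x y) := by
  obtain ⟨γ, hγ, -⟩ := hM.exists_isMinimalGeodesic x y
  exact Classical.epsilon_spec (p := fun γ : ℝ → M => IsMinimalGeodesic x y γ) ⟨γ, hγ⟩

lemma isNPCPoint_geodesicPoint (hM : IsGlobalNPC M) (x y : M) {t : ℝ}
    (ht : t ∈ Icc (0 : ℝ) 1) : IsNPCPoint x y t (geodesicPoint x y t) :=
  hM.isNPCPoint_of_isMinimalGeodesic (hM.isMinimalGeodesic_geodesicPoint x y) ht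

lemma eq_geodesicPoint (hM : IsGlobalNPC M) {x y m : M} {t : ℝ}
    (ht : t ∈ Icc (0 : ℝ) 1) (hm : IsNPCPoint x y t m) : m = geodesicPoint x y t := by
  simpa using hm.dist_le ht ht (hM.isNPCPoint_geodesicPoint x y ht)

theorem isMinimalGeodesic_iff (hM : IsGlobalNPC M) (x y : M) (γ : ℝ → M) :
    IsMinimalGeodesic x y γ ↔ EqOn γ (geodesicPoint x y) (Icc 0 1) := by
  constructor
  · exact fun h t ht => hM.eq_geodesicPoint ht (hM.isNPCPoint_of_isMinimalGeodesic h ht)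
  · intro h
    have hg := hM.isMinimalGeodesic_geodesicPoint x y
    refine ⟨?_, ?_, fun s hs t ht => ?_⟩
    · rw [h (by simp), hg.1]
    · rw [h (by simp), hg.2.1]
    · rw [h hs, h ht, hg.2.2 s hs t ht]

lemma geodesicPoint_self (hM : IsGlobalNPC M) (x : M) {t : ℝ} (ht : t ∈ Icc (0 : ℝ) 1) :
    geodesicPoint x x t = x := by
  simpa using (hM.isNPCPoint_geodesicPoint x x ht).dist_left ht

lemma geodesicPoint_symm (hM : IsGlobalNPC M) (x y : M) {t : ℝ} (ht : t ∈ Icc (0 : ℝ) 1) :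
    geodesicPoint x y t = geodesicPoint y x (1 - t) :=
  hM.eq_geodesicPoint ⟨sub_nonneg.2 ht.2, sub_le_self _ ht.1⟩
    (hM.isNPCPoint_geodesicPoint x y ht).symm

/-- Apply the NPC inequality of the second point at the first, then that of the first at `y'`;
everything cancels except `t² d(y,y')²`. -/
lemma dist_geodesicPoint_right_le (hM : IsGlobalNPC M) (x y y' : M) {t : ℝ}
    (ht : t ∈ Icc (0 : ℝ) 1) :
    dist (geodesicPoint x y t) (geodesicPoint x y' t) ≤ t * dist y y' := by
  have h := hM.isNPCPoint_geodesicPoint x y ht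
  have h1 := hM.isNPCPoint_geodesicPoint x y' ht (geodesicPoint x y t)
  have h2 := h y'
  have h3 := pow_le_pow_left₀ dist_nonneg (h.dist_left ht) 2
  have ht0 := ht.1
  rw [dist_comm y' x, dist_comm y' y] at h2
  rw [dist_comm _ y'] at h1
  refine abs_le_of_sq_le_sq' ?_ (by positivity) |>.2
  have h4 := mul_le_mul_of_nonneg_left h2 ht0
  have h5 := mul_le_mul_of_nonneg_left h3 (sub_nonneg.2 ht.2)
  nlinarith

/-- The metric of a global NPC space is convex along geodesics. -/
theorem dist_geodesicPoint_le (hM : IsGlobalNPC M) (x y x' y' : M) {t : ℝ}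
    (ht : t ∈ Icc (0 : ℝ) 1) :
    dist (geodesicPoint x y t) (geodesicPoint x' y' t) ≤
      (1 - t) * dist x x' + t * dist y y' := by
  have ht' : 1 - t ∈ Icc (0 : ℝ) 1 := ⟨sub_nonneg.2 ht.2, sub_le_self _ ht.1⟩
  -- The diagonal from `x` to `y'` cuts the quadrilateral into two triangles, each treated from a
  -- common vertex.
  have h1 := hM.dist_geodesicPoint_right_le x y y' ht
  have h2 := hM.dist_geodesicPoint_right_le y' x x' ht'
  rw [← hM.geodesicPoint_symm x y' ht, ← hM.geodesicPoint_symm x' y' ht] at h2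
  linarith [dist_triangle (geodesicPoint x y t) (geodesicPoint x y' t) (geodesicPoint x' y' t)]

end IsGlobalNPC

end Geometry

/-! ### Truncation to a ball. -/

section Truncation

variable {M : Type*} [MetricSpace M]

/-- Replace the points at distance at least `R` from `x₀` by `x₀`. -/
noncomputable def truncatePoint (x₀ : M) (R : ℝ) (a : M) : M :=
  open Classical in if dist x₀ a < R then a else x₀

lemma truncatePoint_of_lt {x₀ a : M} {R : ℝ} (h : dist x₀ a < R) : truncatePoint x₀ R a = a := by
  simp [truncatePoint, h]

lemma truncatePoint_of_le {x₀ a : M} {R : ℝ} (h : R ≤ dist x₀ a) :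
    truncatePoint x₀ R a = x₀ := by
  simp [truncatePoint, h]

end Truncation

/-! ### Couplings and membership in `P1 M`. -/

section Measures

variable {M : Type*} [MetricSpace M] [MeasurableSpace M]

/-- The joint law of `f` and `g` is a coupling. Only the inequality `lintegral_map_le` is used,
since `edist` need not be measurable for the product σ-algebra when `M` is not separable. -/
lemma wasserstein1_map_map_le {Ω : Type*} [MeasurableSpace Ω] (P : Measure Ω) {f g : Ω → M}
    (hf : Measurable f) (hg : Measurable g) :
    wasserstein1 (P.map f) (P.map g) ≤ ∫⁻ ω, edist (f ω) (g ω) ∂P := by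
  refine (iInf₂_le (P.map fun ω => (f ω, g ω)) ⟨?_, ?_⟩).trans (lintegral_map_le _ _)
  · rw [Measure.map_map measurable_fst (hf.prodMk hg)]; rfl
  · rw [Measure.map_map measurable_snd (hf.prodMk hg)]; rfl

lemma wasserstein1_dirac_right_le (μ : Measure M) [IsProbabilityMeasure μ] (x : M) :
    wasserstein1 μ (Measure.dirac x) ≤ ∫⁻ y, edist y x ∂μ := by
  have h := wasserstein1_map_map_le μ measurable_id (measurable_const (a := x))
  rwa [Measure.map_id, Measure.map_const, measure_univ, one_smul] at h

/-- Off the support every point has a null neighbourhood, and within a separable set countably many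
of these suffice. -/
lemma measure_compl_support_eq_zero_of_isSeparable {μ : Measure M} {S : Set M}
    (hS : TopologicalSpace.IsSeparable S) (h : μ Sᶜ = 0) : μ (μ.support)ᶜ = 0 := by
  have : TopologicalSpace.SeparableSpace S := hS.separableSpace
  have : SecondCountableTopology S := UniformSpace.secondCountable_of_separable S
  have hL : IsLindelof (S ∩ μ.supportᶜ) := by
    have := (HereditarilyLindelofSpace.isLindelof ((↑) ⁻¹' μ.supportᶜ : Set S)).image
      continuous_subtype_val
    rwa [Subtype.image_preimage_coe] at this
  have h2 : (S ∩ μ.supportᶜ)ᶜ ∈ ae μ := by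
    refine hL.compl_mem_sets_of_nhdsWithin fun s hs => ?_
    obtain ⟨U, hU, hU0⟩ := Measure.notMem_support_iff_exists.mp hs.2
    exact ⟨U, mem_nhdsWithin_of_mem_nhds hU, by rwa [compl_mem_ae_iff]⟩
  rw [compl_mem_ae_iff] at h2
  refine measure_mono_null (fun a ha => ?_) (measure_union_null h h2)
  by_cases haS : a ∈ S
  · exact Or.inr ⟨haS, ha⟩
  · exact Or.inl haS

namespace P1

lemma lintegral_edist_lt_top {μ : Measure M} (hμ : μ ∈ P1 M) (z : M) :
    ∫⁻ y, edist z y ∂μ < ∞ := by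
  obtain ⟨h1, -, x, hx⟩ := hμ
  calc ∫⁻ y, edist z y ∂μ ≤ ∫⁻ y, (edist z x + edist x y) ∂μ :=
        lintegral_mono fun y => edist_triangle _ _ _
    _ = edist z x + ∫⁻ y, edist x y ∂μ := by
        rw [lintegral_add_left measurable_const]; simp
    _ < ∞ := ENNReal.add_lt_top.2 ⟨edist_lt_top _ _, hx⟩

end P1

variable [BorelSpace M]

lemma measurable_const_dist (z : M) : Measurable fun y : M => dist z y :=
  (continuous_const.dist continuous_id).measurable

namespace P1

lemma integrable_dist {μ : Measure M} (hμ : μ ∈ P1 M) (z : M) :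
    Integrable (fun y => dist z y) μ := by
  refine ⟨(measurable_const_dist z).aestronglyMeasurable, ?_⟩
  refine lt_of_le_of_lt (le_of_eq ?_) (lintegral_edist_lt_top hμ z)
  refine lintegral_congr fun y => ?_
  rw [edist_dist, Real.enorm_eq_ofReal dist_nonneg]

end P1

lemma dirac_mem_P1 (x : M) : Measure.dirac x ∈ P1 M := by
  refine ⟨inferInstance, ?_, x, by simp⟩
  have hx : x ∈ (Measure.dirac x).support := by
    rw [Measure.mem_support_iff_forall]
    intro U hU
    rw [Measure.dirac_apply, indicator_of_mem (mem_of_mem_nhds hU)]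
    simp
  simp [hx]

lemma mem_P1_map_of_lipschitzWith {μ : Measure M} (hμ : μ ∈ P1 M) {f : M → M}
    (hf : LipschitzWith 1 f) : μ.map f ∈ P1 M := by
  have hfm : Measurable f := hf.continuous.measurable
  have := hμ.1
  refine ⟨Measure.isProbabilityMeasure_map hfm.aemeasurable, ?_, ?_⟩
  · rw [Measure.map_apply hfm Measure.isClosed_support.measurableSet.compl]
    refine measure_mono_null (fun a (ha : _ ∉ _) (hs : a ∈ _) => ha ?_) hμ.2.1
    rw [Measure.mem_support_iff_forall] at hs ⊢
    intro U hU
    exact (hs _ (hf.continuous.continuousAt hU)).trans_le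
      (Measure.le_map_apply hfm.aemeasurable U)
  · obtain ⟨x, hx⟩ := hμ.2.2
    refine ⟨f x, lt_of_le_of_lt ?_ hx⟩
    refine (lintegral_map_le _ _).trans (lintegral_mono fun y => ?_)
    simpa using hf x y

lemma map_mem_P1 {Ω : Type*} [MeasurableSpace Ω] {P : Measure Ω} [IsProbabilityMeasure P]
    {φ : Ω → M} (hφ : MemL1 P φ) : P.map φ ∈ P1 M := by
  obtain ⟨h, x, hx⟩ := hφ
  refine ⟨Measure.isProbabilityMeasure_map h.aemeasurable, ?_, x,
    (lintegral_map_le _ _).trans_lt hx⟩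
  have hsm := h.stronglyMeasurable_mk
  refine measure_compl_support_eq_zero_of_isSeparable hsm.isSeparable_range.closure ?_
  rw [Measure.map_congr h.ae_eq_mk, Measure.map_apply hsm.measurable
    isClosed_closure.measurableSet.compl]
  convert measure_empty (μ := P)
  ext ω
  simpa using subset_closure (mem_range_self ω)

/-- Leave the common part `α` in place on the diagonal and move `ρ` to `σ` by the normalized product
coupling, routing the cost through `z`. -/
lemma wasserstein1_add_le (α ρ σ : Measure M) [IsFiniteMeasure α] [IsFiniteMeasure ρ]
    [IsFiniteMeasure σ] (h : ρ univ = σ univ) (z : M) :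
    wasserstein1 (α + ρ) (α + σ) ≤ ∫⁻ x, edist z x ∂ρ + ∫⁻ x, edist z x ∂σ := by
  set r := ρ univ with hr
  have hdiag : Measurable fun x : M => (x, x) := measurable_id.prodMk measurable_id
  have hr' : r ≠ ∞ := measure_ne_top ρ univ
  -- For `r = 0` the factor `r⁻¹` is `∞`, but then `ν = 0`.
  have key : ∀ ν : Measure M, ν univ = r → r⁻¹ • r • ν = ν := by
    intro ν hν
    rcases eq_or_ne r 0 with h0 | h0
    · rw [h0, Measure.measure_univ_eq_zero] at hν
      simp [hν]
    · rw [smul_smul, ENNReal.inv_mul_cancel h0 hr', one_smul]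
  set π : Measure (M × M) := α.map (fun x => (x, x)) + r⁻¹ • ρ.prod σ
  have m1 : (r⁻¹ • ρ.prod σ).map Prod.fst = ρ := by
    rw [Measure.map_smul, Measure.map_fst_prod, ← h, key ρ hr.symm]
  have m2 : (r⁻¹ • ρ.prod σ).map Prod.snd = σ := by
    rw [Measure.map_smul, Measure.map_snd_prod, ← hr, key σ h.symm]
  have e1 : π.map Prod.fst = α + ρ := by
    rw [Measure.map_add _ _ measurable_fst, m1, Measure.map_map measurable_fst hdiag]
    congr 1
    exact Measure.map_id
  have e2 : π.map Prod.snd = α + σ := by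
    rw [Measure.map_add _ _ measurable_snd, m2, Measure.map_map measurable_snd hdiag]
    congr 1
    exact Measure.map_id
  refine (iInf₂_le π ⟨e1, e2⟩).trans ?_
  have hz : Measurable fun x : M => edist z x := measurable_edist_right
  rw [lintegral_add_measure]
  have h0 : ∫⁻ p, edist p.1 p.2 ∂(α.map fun x => (x, x)) = 0 := by
    refine le_antisymm ((lintegral_map_le _ _).trans ?_) zero_le
    simp
  rw [h0, zero_add]
  calc ∫⁻ p, edist p.1 p.2 ∂(r⁻¹ • ρ.prod σ)
      ≤ ∫⁻ p, (edist z p.1 + edist z p.2) ∂(r⁻¹ • ρ.prod σ) :=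
        lintegral_mono fun p => edist_triangle_left _ _ _
    _ = ∫⁻ p, edist z p.1 ∂(r⁻¹ • ρ.prod σ) + ∫⁻ p, edist z p.2 ∂(r⁻¹ • ρ.prod σ) :=
        lintegral_add_left (hz.comp measurable_fst) _
    _ = _ := by
        rw [← lintegral_map hz measurable_fst, ← lintegral_map hz measurable_snd, m1, m2]

/-- The common part has weights `min (p x) (q x)`; the truncated differences are the two excesses,
of equal total mass. -/
lemma wasserstein1_sum_dirac_le (F : Finset M) (p q : M → ℝ≥0∞) (hp : ∀ x ∈ F, p x ≠ ∞)
    (hq : ∀ x ∈ F, q x ≠ ∞) (h : ∑ x ∈ F, p x = ∑ x ∈ F, q x) (z : M) :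
    wasserstein1 (∑ x ∈ F, p x • Measure.dirac x) (∑ x ∈ F, q x • Measure.dirac x) ≤
      ∑ x ∈ F, (p x - q x) * edist z x + ∑ x ∈ F, (q x - p x) * edist z x := by
  have hfin : ∀ w : M → ℝ≥0∞, (∀ x ∈ F, w x ≠ ∞) →
      IsFiniteMeasure (∑ x ∈ F, w x • Measure.dirac x) := by
    intro w hw
    refine ⟨?_⟩
    simp only [Measure.coe_finsetSum, Finset.sum_apply, Measure.smul_apply, measure_univ,
      smul_eq_mul, mul_one]
    exact ENNReal.sum_lt_top.2 fun x hx => (hw x hx).lt_top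
  have hmin : ∀ x ∈ F, min (p x) (q x) ≠ ∞ := fun x hx =>
    ((min_le_left _ _).trans_lt (hp x hx).lt_top).ne
  have hsub : ∀ {a b : M → ℝ≥0∞}, (∀ x ∈ F, a x ≠ ∞) → ∀ x ∈ F, a x - b x ≠ ∞ :=
    fun ha x hx => (tsub_le_self.trans_lt (ha x hx).lt_top).ne
  have i1 := hfin (fun x => min (p x) (q x)) hmin
  have i2 := hfin (fun x => p x - q x) (hsub hp)
  have i3 := hfin (fun x => q x - p x) (hsub hq)
  have d1 : ∀ x, min (p x) (q x) + (p x - q x) = p x := fun x => by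
    rcases le_total (p x) (q x) with h | h
    · rw [min_eq_left h, tsub_eq_zero_of_le h, add_zero]
    · rw [min_eq_right h, add_tsub_cancel_of_le h]
  have d2 : ∀ x, min (p x) (q x) + (q x - p x) = q x := fun x => by
    rcases le_total (p x) (q x) with h | h
    · rw [min_eq_left h, add_tsub_cancel_of_le h]
    · rw [min_eq_right h, tsub_eq_zero_of_le h, add_zero]
  have hu : ∑ x ∈ F, (p x - q x) = ∑ x ∈ F, (q x - p x) := by
    have : ∑ x ∈ F, min (p x) (q x) + ∑ x ∈ F, (p x - q x) =
        ∑ x ∈ F, min (p x) (q x) + ∑ x ∈ F, (q x - p x) := by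
      rw [← Finset.sum_add_distrib, ← Finset.sum_add_distrib]
      simpa only [d1, d2] using h
    exact (ENNReal.add_right_inj (ENNReal.sum_ne_top.2 hmin)).1 this
  have hw := wasserstein1_add_le (∑ x ∈ F, min (p x) (q x) • Measure.dirac x)
    (∑ x ∈ F, (p x - q x) • Measure.dirac x) (∑ x ∈ F, (q x - p x) • Measure.dirac x)
    (by simpa [Measure.coe_finsetSum, Finset.sum_apply] using hu) z
  rw [← Finset.sum_add_distrib, ← Finset.sum_add_distrib] at hw
  simp only [← add_smul, d1, d2] at hw
  refine hw.trans (le_of_eq ?_)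
  simp [lintegral_smul_measure]

lemma measurable_truncatePoint (x₀ : M) (R : ℝ) : Measurable (truncatePoint x₀ R) := by
  classical
  unfold truncatePoint
  exact Measurable.ite (measurableSet_lt (measurable_const_dist x₀) measurable_const)
    measurable_id measurable_const

/-- Truncation is discontinuous, so the support is followed by hand: inside the open ball nothing
moves, and the far part, sent to `x₀`, is null unless `x₀` lies in the new support. -/
lemma map_truncatePoint_mem_P1 {μ : Measure M} (hμ : μ ∈ P1 M) (x₀ : M) (R : ℝ) :
    μ.map (truncatePoint x₀ R) ∈ P1 M := by
  have hm := measurable_truncatePoint x₀ R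
  have := hμ.1
  refine ⟨Measure.isProbabilityMeasure_map hm.aemeasurable, ?_, x₀, ?_⟩
  · rw [Measure.map_apply hm Measure.isClosed_support.measurableSet.compl]
    set S := (μ.map (truncatePoint x₀ R)).support
    have hfar : μ {a | R ≤ dist x₀ a ∧ x₀ ∉ S} = 0 := by
      by_cases hx : x₀ ∈ S
      · simp [hx]
      · simp only [hx, not_false_eq_true, and_true]
        obtain ⟨U, hU, hU0⟩ := Measure.notMem_support_iff_exists.1 hx
        refine measure_mono_null (fun a ha => ?_)
          (le_antisymm (hU0 ▸ Measure.le_map_apply hm.aemeasurable U) zero_le)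
        rw [mem_preimage, truncatePoint_of_le ha]
        exact mem_of_mem_nhds hU
    refine measure_mono_null (fun a ha => ?_) (measure_union_null hμ.2.1 hfar)
    rcases lt_or_ge (dist x₀ a) R with h | h
    · left
      rw [mem_preimage, truncatePoint_of_lt h] at ha
      intro hs
      apply ha
      rw [Measure.mem_support_iff_forall] at hs ⊢
      intro U hU
      have hV : U ∩ {b | dist x₀ b < R} ∈ 𝓝 a :=
        inter_mem hU ((isOpen_lt (by fun_prop) continuous_const).mem_nhds h)
      refine (hs _ hV).trans_le ((measure_mono ?_).trans (Measure.le_map_apply hm.aemeasurable U))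
      intro b hb
      rw [mem_preimage, truncatePoint_of_lt hb.2]
      exact hb.1
    · right
      rw [mem_preimage, truncatePoint_of_le h] at ha
      exact ⟨h, ha⟩
  · refine (lintegral_map_le _ _).trans_lt (lt_of_le_of_lt (lintegral_mono fun a => ?_)
      (P1.lintegral_edist_lt_top hμ x₀))
    rcases lt_or_ge (dist x₀ a) R with h | h
    · rw [truncatePoint_of_lt h]
    · simp [truncatePoint_of_le h]

lemma tendsto_lintegral_edist_truncatePoint {μ : Measure M} (hμ : μ ∈ P1 M) (x₀ : M) :
    Tendsto (fun n : ℕ => ∫⁻ a, edist a (truncatePoint x₀ n a) ∂μ) atTop (𝓝 0) := by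
  have h := tendsto_lintegral_of_dominated_convergence (μ := μ) (f := fun _ => (0 : ℝ≥0∞))
    (F := fun (n : ℕ) a => edist a (truncatePoint x₀ n a)) (fun a => edist x₀ a) ?_ ?_
    (P1.lintegral_edist_lt_top hμ x₀).ne ?_
  · simpa using h
  · intro n
    classical
    have : (fun a => edist a (truncatePoint x₀ n a)) =
        fun a => if dist x₀ a < n then 0 else edist a x₀ := by
      ext a
      unfold truncatePoint
      split_ifs <;> simp
    rw [this]
    exact Measurable.ite (measurableSet_lt (measurable_const_dist x₀) measurable_const)
      measurable_const (continuous_id.edist continuous_const).measurable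
  · intro n
    refine .of_forall fun a => ?_
    rcases lt_or_ge (dist x₀ a) n with h | h
    · simp [truncatePoint_of_lt h]
    · simp [truncatePoint_of_le h, edist_comm]
  · refine .of_forall fun a => ?_
    obtain ⟨N, hN⟩ := exists_nat_gt (dist x₀ a)
    refine tendsto_const_nhds.congr' ?_
    filter_upwards [eventually_ge_atTop N] with n hn
    have : dist x₀ a < n := hN.trans_le (by exact_mod_cast hn)
    simp [truncatePoint_of_lt this]

end Measures

lemma ofReal_integral_le_lintegral_ofReal {α : Type*} [MeasurableSpace α] {μ : Measure α}
    {f : α → ℝ} (hf : Integrable f μ) :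
    ENNReal.ofReal (∫ x, f x ∂μ) ≤ ∫⁻ x, ENNReal.ofReal (f x) ∂μ := by
  calc ENNReal.ofReal (∫ x, f x ∂μ) ≤ ENNReal.ofReal (∫ x, max (f x) 0 ∂μ) :=
        ENNReal.ofReal_le_ofReal (integral_mono hf hf.pos_part fun x => le_max_left _ _)
    _ = ∫⁻ x, ENNReal.ofReal (max (f x) 0) ∂μ :=
        ofReal_integral_eq_lintegral_ofReal hf.pos_part (.of_forall fun x => le_max_right _ _)
    _ = ∫⁻ x, ENNReal.ofReal (f x) ∂μ := by simp

/-! ### The canonical barycenter: existence, uniqueness, contractivity. -/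

section Barycenter

variable {M : Type*} [MetricSpace M]

lemma abs_sq_dist_sub_sq_dist_le (y z x : M) :
    |dist z x ^ 2 - dist y x ^ 2| ≤ dist z y * (dist z x + dist y x) := by
  have h : dist z x ^ 2 - dist y x ^ 2 = (dist z x - dist y x) * (dist z x + dist y x) := by ring
  rw [h, abs_mul, abs_of_nonneg (by positivity : 0 ≤ dist z x + dist y x)]
  exact mul_le_mul_of_nonneg_right (abs_dist_sub_le z y x) (by positivity)

variable [MeasurableSpace M]

/-- The functional `z ↦ ∫ [d(z,x)² - d(y,x)²] dμ(x)` minimized by the canonical barycenter. -/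
noncomputable def sqDistGap (μ : Measure M) (y z : M) : ℝ :=
  ∫ x, (dist z x ^ 2 - dist y x ^ 2) ∂μ

variable [BorelSpace M] {μ ν : Measure M}

lemma integrable_sq_dist_sub (hμ : μ ∈ P1 M) (y z : M) :
    Integrable (fun x => dist z x ^ 2 - dist y x ^ 2) μ := by
  refine (((P1.integrable_dist hμ z).add (P1.integrable_dist hμ y)).const_mul (dist z y)).mono'
    (((measurable_const_dist z).pow_const 2).sub
      ((measurable_const_dist y).pow_const 2)).aestronglyMeasurable ?_
  exact .of_forall fun x => abs_sq_dist_sub_sq_dist_le y z x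

lemma sqDistGap_add (hμ : μ ∈ P1 M) (y z w : M) :
    sqDistGap μ y z + sqDistGap μ z w = sqDistGap μ y w := by
  unfold sqDistGap
  rw [← integral_add (integrable_sq_dist_sub hμ y z) (integrable_sq_dist_sub hμ z w)]
  congr 1
  ext x
  ring

lemma sqDistGap_le (hμ : μ ∈ P1 M) (y z : M) :
    sqDistGap μ y z ≤ dist z y * (dist z y + 2 * ∫ x, dist z x ∂μ) := by
  have := hμ.1
  have hz := P1.integrable_dist hμ z
  have h1 : ∫ x, dist z y * (dist z y + 2 * dist z x) ∂μ =
      dist z y * (dist z y + 2 * ∫ x, dist z x ∂μ) := by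
    rw [integral_const_mul, integral_add (integrable_const _) (hz.const_mul 2),
      integral_const_mul]
    simp
  rw [← h1]
  refine integral_mono (integrable_sq_dist_sub hμ y z)
    (((integrable_const _).add (hz.const_mul 2)).const_mul _) fun x => ?_
  refine (le_abs_self _).trans ((abs_sq_dist_sub_sq_dist_le y z x).trans ?_)
  refine mul_le_mul_of_nonneg_left ?_ dist_nonneg
  linarith [dist_triangle y z x, dist_comm y z]

/-- From `d(z,x) ≥ |d(z,y) - d(y,x)|` the gap is at least `r² - 2rc` with `r = d(z,y)` and `c` the
mean distance to `y`; now complete the square. -/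
lemma le_sqDistGap (hμ : μ ∈ P1 M) (y z : M) :
    -(∫ x, dist y x ∂μ) ^ 2 ≤ sqDistGap μ y z := by
  have := hμ.1
  have hy := P1.integrable_dist hμ y
  have h1 : ∫ x, (dist z y ^ 2 - 2 * dist z y * dist y x) ∂μ =
      dist z y ^ 2 - 2 * dist z y * ∫ x, dist y x ∂μ := by
    rw [integral_sub (integrable_const _) (hy.const_mul _), integral_const_mul]
    simp
  have h2 : ∫ x, (dist z y ^ 2 - 2 * dist z y * dist y x) ∂μ ≤ sqDistGap μ y z := by
    refine integral_mono ((integrable_const _).sub (hy.const_mul _))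
      (integrable_sq_dist_sub hμ y z) fun x => ?_
    have h3 : |dist z y - dist y x| ≤ |dist z x| := by
      rw [abs_of_nonneg (dist_nonneg (x := z)), abs_le]
      constructor
      · linarith [dist_triangle y z x, dist_comm y z]
      · linarith [dist_triangle z x y, dist_comm y x]
    have := sq_le_sq.2 h3
    simp only
    linarith
  nlinarith [sq_nonneg (dist z y - ∫ x, dist y x ∂μ)]

lemma IsNPCPoint.sqDistGap_le (hμ : μ ∈ P1 M) (y : M) {z w m : M} {t : ℝ}
    (hm : IsNPCPoint z w t m) :
    sqDistGap μ y m ≤ (1 - t) * sqDistGap μ y z + t * sqDistGap μ y w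
      - t * (1 - t) * dist z w ^ 2 := by
  have := hμ.1
  have hz := integrable_sq_dist_sub hμ y z
  have hw := integrable_sq_dist_sub hμ y w
  have h1 : ∫ x, ((1 - t) * (dist z x ^ 2 - dist y x ^ 2) + t * (dist w x ^ 2 - dist y x ^ 2)
      - t * (1 - t) * dist z w ^ 2) ∂μ = (1 - t) * sqDistGap μ y z + t * sqDistGap μ y w
      - t * (1 - t) * dist z w ^ 2 := by
    have h2 : ∫ x, ((1 - t) * (dist z x ^ 2 - dist y x ^ 2) +
        t * (dist w x ^ 2 - dist y x ^ 2)) ∂μ = (1 - t) * sqDistGap μ y z + t * sqDistGap μ y w := by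
      rw [integral_add (hz.const_mul _) (hw.const_mul _), integral_const_mul, integral_const_mul]
      rfl
    rw [integral_sub (by exact (hz.const_mul _).add (hw.const_mul _)) (integrable_const _), h2]
    simp
  rw [← h1]
  refine integral_mono (integrable_sq_dist_sub hμ y m)
    (((hz.const_mul _).add (hw.const_mul _)).sub (integrable_const _)) fun x => ?_
  have h2 := hm x
  simp only [dist_comm x] at h2 ⊢
  linarith

namespace IsGlobalNPC

/-- The integrated NPC inequality makes the functional uniformly convex, so comparing with midpoints
shows that a minimizing sequence is Cauchy. A change of base point only adds a constant. -/
lemma exists_isCanonicalBarycenter [Nonempty M] (hM : IsGlobalNPC M) (hμ : μ ∈ P1 M) :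
    ∃ z, IsCanonicalBarycenter μ z := by
  have := hM.complete
  obtain ⟨y⟩ := ‹Nonempty M›
  have hbdd : BddBelow (range (sqDistGap μ y)) :=
    ⟨_, forall_mem_range.2 fun z => le_sqDistGap hμ y z⟩
  set I := sInf (range (sqDistGap μ y))
  have hI : ∀ z, I ≤ sqDistGap μ y z := fun z => csInf_le hbdd (mem_range_self z)
  have hex : ∀ n : ℕ, ∃ z, sqDistGap μ y z < I + 1 / ((n : ℝ) + 1) := fun n => by
    obtain ⟨_, ⟨z, rfl⟩, hz⟩ := exists_lt_of_csInf_lt (range_nonempty (sqDistGap μ y))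
      (lt_add_of_pos_right I (Nat.one_div_pos_of_nat (n := n)))
    exact ⟨z, hz⟩
  choose z hz using hex
  have hd : ∀ n m, dist (z n) (z m) ^ 2 ≤ 2 * (1 / ((n : ℝ) + 1) + 1 / ((m : ℝ) + 1)) := by
    intro n m
    obtain ⟨p, hp⟩ := hM.exists_isNPCPoint (z n) (z m) (t := 1 / 2) ⟨by norm_num, by norm_num⟩
    have h1 := hp.sqDistGap_le hμ y
    linarith [hI p, hz n, hz m]
  have hc : CauchySeq z := by
    rw [Metric.cauchySeq_iff']
    intro ε hε
    obtain ⟨N, hN⟩ := exists_nat_one_div_lt (by positivity : 0 < ε ^ 2 / 4)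
    refine ⟨N, fun n hn => abs_lt_of_sq_lt_sq' ((hd n N).trans_lt ?_) hε.le |>.2⟩
    have := one_div_le_one_div_of_le (by positivity : (0 : ℝ) < N + 1)
      (by exact_mod_cast Nat.succ_le_succ hn : (N : ℝ) + 1 ≤ n + 1)
    linarith
  obtain ⟨b, hb⟩ := cauchySeq_tendsto_of_complete hc
  have hbI : sqDistGap μ y b ≤ I := by
    have h1 : ∀ n : ℕ, sqDistGap μ y b ≤ I + 1 / ((n : ℝ) + 1) +
        dist b (z n) * (dist b (z n) + 2 * ∫ x, dist b x ∂μ) := fun n => by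
      have h2 := sqDistGap_le hμ (z n) b
      have h3 := sqDistGap_add hμ y (z n) b
      linarith [hz n]
    have h4 : Tendsto (fun n => dist b (z n)) atTop (𝓝 0) := by
      simpa using (tendsto_const_nhds (x := b)).dist hb
    have h5 := (tendsto_const_nhds (x := I)).add tendsto_one_div_add_atTop_nhds_zero_nat
      |>.add (h4.mul (h4.add_const (2 * ∫ x, dist b x ∂μ)))
    simpa using ge_of_tendsto' h5 h1
  refine ⟨b, fun y' w => ?_⟩
  have h1 := sqDistGap_add hμ y' y b
  have h2 := sqDistGap_add hμ y' y w
  have h3 := hI w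
  change sqDistGap μ y' b ≤ sqDistGap μ y' w
  linarith

/-- The variance inequality. -/
lemma sq_dist_le_sqDistGap (hM : IsGlobalNPC M) (hμ : μ ∈ P1 M) {b : M}
    (hb : IsCanonicalBarycenter μ b) (w : M) : dist b w ^ 2 ≤ sqDistGap μ b w := by
  have h0 : sqDistGap μ b b = 0 := by simp [sqDistGap]
  -- Compare `b` with the point at parameter `t` towards `w` and divide by `t`; then let `t → 0`.
  have key : ∀ t ∈ Ioo (0 : ℝ) 1, (1 - t) * dist b w ^ 2 ≤ sqDistGap μ b w := by
    intro t ht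
    obtain ⟨m, hm⟩ := hM.exists_isNPCPoint b w ⟨ht.1.le, ht.2.le⟩
    have h1 := hm.sqDistGap_le hμ b
    have h2 : sqDistGap μ b b ≤ sqDistGap μ b m := hb b m
    rw [h0] at h1 h2
    have h3 : t * ((1 - t) * dist b w ^ 2) ≤ t * sqDistGap μ b w := by linarith
    exact le_of_mul_le_mul_left h3 ht.1
  have hlim : Tendsto (fun t : ℝ => (1 - t) * dist b w ^ 2) (𝓝[>] 0) (𝓝 ((1 - 0) * dist b w ^ 2)) :=
    ((continuous_const.sub continuous_id).mul continuous_const).continuousAt.tendsto.mono_left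
      nhdsWithin_le_nhds
  have := le_of_tendsto hlim (mem_of_superset (Ioo_mem_nhdsGT one_pos) key)
  simpa using this

lemma eq_of_isCanonicalBarycenter (hM : IsGlobalNPC M) (hμ : μ ∈ P1 M) {b b' : M}
    (hb : IsCanonicalBarycenter μ b) (hb' : IsCanonicalBarycenter μ b') : b = b' := by
  have h1 := hM.sq_dist_le_sqDistGap hμ hb b'
  have h2 : sqDistGap μ b b' ≤ sqDistGap μ b b := hb' b b
  have h3 : sqDistGap μ b b = 0 := by simp [sqDistGap]
  have h4 : dist b b' ^ 2 = 0 := le_antisymm (by linarith) (sq_nonneg _)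
  exact dist_eq_zero.1 (pow_eq_zero_iff two_ne_zero |>.1 h4)

variable [Nonempty M]

lemma isCanonicalBarycenter_canonicalBarycenter (hM : IsGlobalNPC M) (hμ : μ ∈ P1 M) :
    IsCanonicalBarycenter μ (canonicalBarycenter μ) :=
  Classical.epsilon_spec (p := fun z => IsCanonicalBarycenter μ z)
    (hM.exists_isCanonicalBarycenter hμ)

theorem eq_canonicalBarycenter_iff (hM : IsGlobalNPC M) (hμ : μ ∈ P1 M) (z : M) :
    z = canonicalBarycenter μ ↔ IsCanonicalBarycenter μ z :=
  ⟨fun h => h ▸ hM.isCanonicalBarycenter_canonicalBarycenter hμ, fun h =>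
    hM.eq_of_isCanonicalBarycenter hμ h (hM.isCanonicalBarycenter_canonicalBarycenter hμ)⟩

lemma canonicalBarycenter_dirac (hM : IsGlobalNPC M) (x : M) :
    canonicalBarycenter (Measure.dirac x) = x := by
  refine ((hM.eq_canonicalBarycenter_iff (dirac_mem_P1 x) x).2 fun y w => ?_).symm
  rw [integral_dirac, integral_dirac, dist_self]
  have := sq_nonneg (dist w x)
  linarith

/-- Add the variance inequalities of `μ` at `y` and of `ν` at `x`, and integrate over a coupling.
Quadruple comparison gives `2D² ≤ 2D ∫ d dπ` for `D = d(x,y)`; divide by `2D`. -/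
lemma edist_canonicalBarycenter_le (hM : IsGlobalNPC M) (hμ : μ ∈ P1 M) (hν : ν ∈ P1 M) :
    edist (canonicalBarycenter μ) (canonicalBarycenter ν) ≤ wasserstein1 μ ν := by
  set x := canonicalBarycenter μ
  set y := canonicalBarycenter ν
  refine le_iInf₂ fun π hπ => ?_
  rcases eq_or_ne x y with hxy | hxy
  · simp [hxy]
  have hD := dist_pos.2 hxy
  have h1 := hM.sq_dist_le_sqDistGap hμ (hM.isCanonicalBarycenter_canonicalBarycenter hμ) y
  have h2 := hM.sq_dist_le_sqDistGap hν (hM.isCanonicalBarycenter_canonicalBarycenter hν) x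
  change dist x y ^ 2 ≤ _ at h1
  change dist y x ^ 2 ≤ _ at h2
  rw [dist_comm] at h2
  have i1 : Integrable (fun p : M × M => dist y p.1 ^ 2 - dist x p.1 ^ 2) π :=
    Integrable.comp_measurable (g := fun p => dist y p ^ 2 - dist x p ^ 2)
      (hπ.1.symm ▸ integrable_sq_dist_sub hμ x y) measurable_fst
  have i2 : Integrable (fun p : M × M => dist x p.2 ^ 2 - dist y p.2 ^ 2) π :=
    Integrable.comp_measurable (g := fun p => dist x p ^ 2 - dist y p ^ 2)
      (hπ.2.symm ▸ integrable_sq_dist_sub hν y x) measurable_snd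
  have e1 : sqDistGap μ x y = ∫ p : M × M, (dist y p.1 ^ 2 - dist x p.1 ^ 2) ∂π := by
    rw [sqDistGap, ← hπ.1, integral_map measurable_fst.aemeasurable]
    rw [hπ.1]
    exact (integrable_sq_dist_sub hμ x y).aestronglyMeasurable
  have e2 : sqDistGap ν y x = ∫ p : M × M, (dist x p.2 ^ 2 - dist y p.2 ^ 2) ∂π := by
    rw [sqDistGap, ← hπ.2, integral_map measurable_snd.aemeasurable]
    rw [hπ.2]
    exact (integrable_sq_dist_sub hν y x).aestronglyMeasurable
  have h3 : 2 * dist x y ^ 2 ≤ ∫ p : M × M, ((dist y p.1 ^ 2 - dist x p.1 ^ 2) +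
      (dist x p.2 ^ 2 - dist y p.2 ^ 2)) ∂π := by
    rw [integral_add i1 i2, ← e1, ← e2]
    linarith
  have h4 : ENNReal.ofReal (2 * dist x y ^ 2) ≤
      ENNReal.ofReal (2 * dist x y) * ∫⁻ p, edist p.1 p.2 ∂π := by
    rw [← lintegral_const_mul' _ _ ENNReal.ofReal_ne_top]
    refine (ENNReal.ofReal_le_ofReal h3).trans ((ofReal_integral_le_lintegral_ofReal (i1.add i2)).trans
      (lintegral_mono fun p => ?_))
    rw [edist_dist, ← ENNReal.ofReal_mul (by positivity)]
    refine ENNReal.ofReal_le_ofReal ?_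
    have := hM.quadrilateral x y p.1 p.2
    simp only [Pi.add_apply]
    linarith
  rw [show 2 * dist x y ^ 2 = 2 * dist x y * dist x y by ring,
    ENNReal.ofReal_mul (by positivity), ← edist_dist] at h4
  exact (ENNReal.mul_le_mul_iff_right (by simpa using hD.ne') ENNReal.ofReal_ne_top).1 h4

theorem isContractiveBarycentricMap_canonicalBarycenter (hM : IsGlobalNPC M) :
    IsContractiveBarycentricMap (canonicalBarycenter : Measure M → M) :=
  ⟨hM.canonicalBarycenter_dirac, fun _ hμ _ hν => hM.edist_canonicalBarycenter_le hμ hν⟩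

end IsGlobalNPC

end Barycenter

/-! ### The maps `β_t` and their limit as `t → 0⁺`. -/

namespace IsGlobalNPC

variable {M : Type*} [MetricSpace M] [Nonempty M] {t : ℝ}

lemma lipschitzWith_geodesicPoint (hM : IsGlobalNPC M) (x : M) (ht : t ∈ Icc (0 : ℝ) 1) :
    LipschitzWith 1 fun a => geodesicPoint x a t := by
  refine LipschitzWith.of_dist_le_mul fun a b => ?_
  refine (hM.dist_geodesicPoint_right_le x a b ht).trans ?_
  simpa using mul_le_of_le_one_left dist_nonneg ht.2

lemma edist_geodesicPoint_le (hM : IsGlobalNPC M) (x y x' y' : M) (ht : t ∈ Icc (0 : ℝ) 1) :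
    edist (geodesicPoint x y t) (geodesicPoint x' y' t) ≤
      ENNReal.ofReal (1 - t) * edist x x' + ENNReal.ofReal t * edist y y' := by
  have h1 := sub_nonneg.2 ht.2
  rw [edist_dist, edist_dist, edist_dist, ← ENNReal.ofReal_mul h1, ← ENNReal.ofReal_mul ht.1,
    ← ENNReal.ofReal_add (by positivity) (mul_nonneg ht.1 dist_nonneg)]
  exact ENNReal.ofReal_le_ofReal (hM.dist_geodesicPoint_le x y x' y' ht)

end IsGlobalNPC

section Flow

variable {M : Type*} [MetricSpace M] [MeasurableSpace M] [BorelSpace M] {β : Measure M → M}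
  {μ ν : Measure M}

lemma IsContractiveBarycentricMap.edist_dirac_le (hβ : IsContractiveBarycentricMap β)
    (hμ : μ ∈ P1 M) (x : M) : edist (β μ) x ≤ ∫⁻ y, edist x y ∂μ := by
  have := hμ.1
  have h := (hβ.2 μ hμ _ (dirac_mem_P1 x)).trans (wasserstein1_dirac_right_le μ x)
  rw [hβ.1] at h
  simpa only [edist_comm x] using h

lemma IsContractiveBarycentricMap.dist_dirac_le (hβ : IsContractiveBarycentricMap β)
    (hμ : μ ∈ P1 M) (x : M) : dist (β μ) x ≤ ∫ y, dist x y ∂μ := by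
  have h := hβ.edist_dirac_le hμ x
  rw [integral_eq_lintegral_of_nonneg_ae (.of_forall fun y => dist_nonneg)
    (measurable_const_dist x).aestronglyMeasurable, dist_edist]
  simp only [← edist_dist]
  exact ENNReal.toReal_mono (P1.lintegral_edist_lt_top hμ x).ne h

variable [Nonempty M] {t : ℝ}

namespace IsGlobalNPC

lemma measurable_geodesicPoint (hM : IsGlobalNPC M) (x : M) (ht : t ∈ Icc (0 : ℝ) 1) :
    Measurable fun a => geodesicPoint x a t :=
  (hM.lipschitzWith_geodesicPoint x ht).continuous.measurable

lemma geodesicPush_mem_P1 (hM : IsGlobalNPC M) (x : M) (ht : t ∈ Icc (0 : ℝ) 1)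
    (hμ : μ ∈ P1 M) : geodesicPush x t μ ∈ P1 M :=
  mem_P1_map_of_lipschitzWith hμ (hM.lipschitzWith_geodesicPoint x ht)

lemma wasserstein1_geodesicPush_le (hM : IsGlobalNPC M) (x y : M) (ht : t ∈ Icc (0 : ℝ) 1)
    (π : Measure (M × M)) [IsProbabilityMeasure π] :
    wasserstein1 (geodesicPush x t (π.map Prod.fst)) (geodesicPush y t (π.map Prod.snd)) ≤
      ENNReal.ofReal (1 - t) * edist x y + ENNReal.ofReal t * ∫⁻ p, edist p.1 p.2 ∂π := by
  have hx := hM.measurable_geodesicPoint x ht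
  have hy := hM.measurable_geodesicPoint y ht
  unfold geodesicPush
  rw [Measure.map_map hx measurable_fst, Measure.map_map hy measurable_snd]
  refine (wasserstein1_map_map_le π (hx.comp measurable_fst) (hy.comp measurable_snd)).trans ?_
  refine (lintegral_mono fun p : M × M => hM.edist_geodesicPoint_le x p.1 y p.2 ht).trans ?_
  rw [lintegral_add_left measurable_const,
    lintegral_const_mul' (ENNReal.ofReal t) (fun p : M × M => edist p.1 p.2) ENNReal.ofReal_ne_top]
  simp

/-- Only the starting point of the geodesics moves, and convexity of the metric weights it by `1 -
t`. -/
lemma contractingWith_geodesicPush (hM : IsGlobalNPC M) (hβ : IsContractiveBarycentricMap β)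
    (ht : t ∈ Ioc (0 : ℝ) 1) (hμ : μ ∈ P1 M) :
    ContractingWith (1 - t).toNNReal fun x => β (geodesicPush x t μ) := by
  have ht' : t ∈ Icc (0 : ℝ) 1 := ⟨ht.1.le, ht.2⟩
  have := hμ.1
  refine ⟨by rw [Real.toNNReal_lt_one]; linarith [ht.1], fun x y => ?_⟩
  refine (hβ.2 _ (hM.geodesicPush_mem_P1 x ht' hμ) _ (hM.geodesicPush_mem_P1 y ht' hμ)).trans ?_
  refine (wasserstein1_map_map_le μ (hM.measurable_geodesicPoint x ht')
    (hM.measurable_geodesicPoint y ht')).trans ?_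
  refine (lintegral_mono fun a => hM.edist_geodesicPoint_le x a y a ht').trans ?_
  simp [ENNReal.ofReal]

theorem eq_barycenterFlow_iff (hM : IsGlobalNPC M) (hβ : IsContractiveBarycentricMap β)
    (ht : t ∈ Ioc (0 : ℝ) 1) (hμ : μ ∈ P1 M) (x : M) :
    x = barycenterFlow t β μ ↔ x = β (geodesicPush x t μ) := by
  have := hM.complete
  have hc := hM.contractingWith_geodesicPush hβ ht hμ
  have hspec : barycenterFlow t β μ = β (geodesicPush (barycenterFlow t β μ) t μ) :=
    Classical.epsilon_spec (p := fun x : M => x = β (geodesicPush x t μ))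
      ⟨_, hc.fixedPoint_isFixedPt.symm⟩
  refine ⟨fun h => ?_, fun h => ?_⟩
  · rw [h]
    exact hspec
  · exact hc.fixedPoint_unique' h.symm hspec.symm

lemma barycenterFlow_eq (hM : IsGlobalNPC M) (hβ : IsContractiveBarycentricMap β)
    (ht : t ∈ Ioc (0 : ℝ) 1) (hμ : μ ∈ P1 M) :
    barycenterFlow t β μ = β (geodesicPush (barycenterFlow t β μ) t μ) :=
  (hM.eq_barycenterFlow_iff hβ ht hμ _).1 rfl

theorem isContractiveBarycentricMap_barycenterFlow (hM : IsGlobalNPC M)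
    (hβ : IsContractiveBarycentricMap β) (ht : t ∈ Ioc (0 : ℝ) 1) :
    IsContractiveBarycentricMap (barycenterFlow t β) := by
  have ht' : t ∈ Icc (0 : ℝ) 1 := ⟨ht.1.le, ht.2⟩
  refine ⟨fun x => ?_, fun μ hμ ν hν => le_iInf₂ fun π hπ => ?_⟩
  · refine ((hM.eq_barycenterFlow_iff hβ ht (dirac_mem_P1 x) x).2 ?_).symm
    rw [geodesicPush, Measure.map_dirac' (hM.measurable_geodesicPoint x ht'),
      hM.geodesicPoint_self x ht', hβ.1]
  · have hπ1 : IsProbabilityMeasure π := by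
      have := hμ.1
      rw [← hπ.1] at this
      exact Measure.isProbabilityMeasure_of_map Prod.fst
    set x := barycenterFlow t β μ with hx
    set y := barycenterFlow t β ν with hy
    have h := hβ.2 _ (hM.geodesicPush_mem_P1 x ht' hμ) _ (hM.geodesicPush_mem_P1 y ht' hν)
    rw [hx, hy, ← hM.barycenterFlow_eq hβ ht hμ, ← hM.barycenterFlow_eq hβ ht hν, ← hx, ← hy] at h
    have h2 := hM.wasserstein1_geodesicPush_le x y ht' π
    rw [hπ.1, hπ.2] at h2
    have h3 := h.trans h2
    have e : edist x y = ENNReal.ofReal (1 - t) * edist x y + ENNReal.ofReal t * edist x y := by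
      rw [← add_mul, ← ENNReal.ofReal_add (sub_nonneg.2 ht.2) ht.1.le]
      simp
    conv_lhs at h3 => rw [e]
    -- The estimate reads `D ≤ (1-t)D + t ∫ d dπ`; as `D` is finite, the first term is absorbed and
    -- `t` cancels.
    have h4 := (ENNReal.add_le_add_iff_left
      (ENNReal.mul_ne_top ENNReal.ofReal_ne_top (edist_ne_top x y))).1 h3
    exact (ENNReal.mul_le_mul_iff_right (by simpa using ht.1) ENNReal.ofReal_ne_top).1 h4

/-! ### The flow converges to the canonical barycenter -/

/-- Bound `2D d(b, x #_t a)` by `D² + d(b, x #_t a)²` and use the NPC inequality to get, after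
integration, `2D² ≤ 2D² + t(G - D²) + t²(2R)²` with `G = sqDistGap μ x b`. The variance inequality
gives `G ≤ -D²`, so the first-order term is at most `-2tD²` and beats the quadratic error. -/
lemma sq_dist_canonicalBarycenter_barycenterFlow_le (hM : IsGlobalNPC M)
    (hβ : IsContractiveBarycentricMap β) (ht : t ∈ Ioc (0 : ℝ) 1) (hμ : μ ∈ P1 M) {x₀ : M}
    {R : ℝ} (hR : ∀ᵐ a ∂μ, dist x₀ a ≤ R) :
    2 * dist (canonicalBarycenter μ) (barycenterFlow t β μ) ^ 2 ≤ t * (2 * R) ^ 2 := by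
  have ht' : t ∈ Icc (0 : ℝ) 1 := ⟨ht.1.le, ht.2⟩
  have := hμ.1
  set b := canonicalBarycenter μ
  set x := barycenterFlow t β μ with hx
  set D := dist b x with hD
  have hxR : dist x x₀ ≤ R := by
    refine ((hM.isContractiveBarycentricMap_barycenterFlow hβ ht).dist_dirac_le hμ x₀).trans ?_
    refine (integral_mono_ae (P1.integrable_dist hμ x₀) (integrable_const R) hR).trans ?_
    simp
  have hpush := hM.geodesicPush_mem_P1 x ht' hμ
  have hm := hM.measurable_geodesicPoint x ht'
  have hint : Integrable (fun a => dist b (geodesicPoint x a t)) μ :=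
    (P1.integrable_dist hpush b).comp_measurable hm
  have h1 : D ≤ ∫ a, dist b (geodesicPoint x a t) ∂μ := by
    have h := hβ.dist_dirac_le hpush b
    rw [hx, ← hM.barycenterFlow_eq hβ ht hμ, ← hx, dist_comm, geodesicPush,
      integral_map hm.aemeasurable (measurable_const_dist b).aestronglyMeasurable] at h
    exact h
  have hi := integrable_sq_dist_sub hμ x b
  have h2 : 2 * D * ∫ a, dist b (geodesicPoint x a t) ∂μ ≤
      2 * D ^ 2 + t * (sqDistGap μ x b - D ^ 2) + t ^ 2 * (2 * R) ^ 2 := by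
    have e : ∫ a, (t * (dist b a ^ 2 - dist x a ^ 2) +
        (2 * D ^ 2 - t * D ^ 2 + t ^ 2 * (2 * R) ^ 2)) ∂μ =
        2 * D ^ 2 + t * (sqDistGap μ x b - D ^ 2) + t ^ 2 * (2 * R) ^ 2 := by
      rw [integral_add (hi.const_mul t) (integrable_const _), integral_const_mul]
      simp only [integral_const, probReal_univ, one_smul, sqDistGap]
      ring
    rw [← e, ← integral_const_mul]
    refine integral_mono_ae (hint.const_mul _) ((hi.const_mul t).add (integrable_const _)) ?_
    filter_upwards [hR] with a ha
    have h3 := hM.isNPCPoint_geodesicPoint x a ht' b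
    have h4 : dist x a ^ 2 ≤ (2 * R) ^ 2 :=
      pow_le_pow_left₀ dist_nonneg (by linarith [dist_triangle x x₀ a]) 2
    have h5 := two_mul_le_add_sq D (dist b (geodesicPoint x a t))
    have h6 := mul_le_mul_of_nonneg_left h4 (sq_nonneg t)
    rw [← hD] at h3
    linarith
  have h3 := hM.sq_dist_le_sqDistGap hμ (hM.isCanonicalBarycenter_canonicalBarycenter hμ) x
  have h4 := sqDistGap_add hμ x b x
  have h5 : sqDistGap μ x x = 0 := by simp [sqDistGap]
  have h6 : 2 * D * D ≤ 2 * D * ∫ a, dist b (geodesicPoint x a t) ∂μ :=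
    mul_le_mul_of_nonneg_left h1 (by positivity)
  have h7 : t * (2 * D ^ 2) ≤ t * (t * (2 * R) ^ 2) := by
    have h8 : t * (sqDistGap μ x b - D ^ 2) ≤ t * (-D ^ 2 - D ^ 2) :=
      mul_le_mul_of_nonneg_left (by linarith) ht.1.le
    linarith
  exact le_of_mul_le_mul_left h7 ht.1

lemma tendsto_barycenterFlow_of_bounded (hM : IsGlobalNPC M)
    (hβ : IsContractiveBarycentricMap β) (hμ : μ ∈ P1 M) {x₀ : M} {R : ℝ}
    (hR : ∀ᵐ a ∂μ, dist x₀ a ≤ R) :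
    Tendsto (fun t : ℝ => barycenterFlow t β μ) (𝓝[>] 0) (𝓝 (canonicalBarycenter μ)) := by
  rw [tendsto_iff_dist_tendsto_zero]
  have h0 : Tendsto (fun t : ℝ => √(t * (2 * R) ^ 2)) (𝓝[>] 0) (𝓝 0) := by
    have : Continuous fun t : ℝ => √(t * (2 * R) ^ 2) := by fun_prop
    simpa using (this.tendsto 0).mono_left nhdsWithin_le_nhds
  refine squeeze_zero' (.of_forall fun t => dist_nonneg) ?_ h0
  filter_upwards [Ioc_mem_nhdsGT one_pos] with t ht
  have h := hM.sq_dist_canonicalBarycenter_barycenterFlow_le hβ ht hμ hR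
  rw [dist_comm]
  refine Real.le_sqrt_of_sq_le ?_
  linarith [sq_nonneg (dist (canonicalBarycenter μ) (barycenterFlow t β μ))]

/-- The maps `β_t` converge pointwise to the canonical barycentric map as `t → 0⁺`. -/
theorem tendsto_barycenterFlow (hM : IsGlobalNPC M)
    (hβ : IsContractiveBarycentricMap β) (hμ : μ ∈ P1 M) :
    Tendsto (fun t : ℝ => barycenterFlow t β μ) (𝓝[>] 0) (𝓝 (canonicalBarycenter μ)) := by
  have := hμ.1
  obtain ⟨x₀⟩ := ‹Nonempty M›
  rw [tendsto_iff_edist_tendsto_0, ENNReal.tendsto_nhds_zero]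
  intro ε hε
  have hε3 : 0 < ε / 3 := ENNReal.div_pos hε.ne' (by simp)
  obtain ⟨n, hn⟩ := ((ENNReal.tendsto_nhds_zero.1
    (tendsto_lintegral_edist_truncatePoint hμ x₀)) _ hε3).exists
  -- Replacing `μ` by `μ'` moves every barycenter by at most `ε/3`, uniformly in `t`.
  set μ' := μ.map (truncatePoint x₀ n)
  have hm := measurable_truncatePoint x₀ (n : ℝ)
  have hμ' : μ' ∈ P1 M := map_truncatePoint_mem_P1 hμ x₀ n
  have hW : wasserstein1 μ μ' ≤ ε / 3 := by
    have := wasserstein1_map_map_le μ measurable_id hm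
    rw [Measure.map_id] at this
    exact this.trans hn
  have hR : ∀ᵐ a ∂μ', dist x₀ a ≤ n := by
    rw [ae_map_iff hm.aemeasurable (measurableSet_le (measurable_const_dist x₀) measurable_const)]
    refine .of_forall fun a => ?_
    rcases lt_or_ge (dist x₀ a) n with h | h
    · rw [truncatePoint_of_lt h]
      exact h.le
    · simp [truncatePoint_of_le h]
  have hconv := tendsto_iff_edist_tendsto_0.1 (hM.tendsto_barycenterFlow_of_bounded hβ hμ' hR)
  filter_upwards [Ioc_mem_nhdsGT one_pos, ENNReal.tendsto_nhds_zero.1 hconv _ hε3] with t ht h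
  have h1 := ((hM.isContractiveBarycentricMap_barycenterFlow hβ ht).2 μ hμ μ' hμ').trans hW
  have h2 := (hM.edist_canonicalBarycenter_le hμ hμ').trans hW
  rw [edist_comm] at h2
  calc _ ≤ _ := edist_triangle4 _ (barycenterFlow t β μ') (canonicalBarycenter μ') _
    _ ≤ ε / 3 + ε / 3 + ε / 3 := add_le_add (add_le_add h1 h) h2
    _ = ε := ENNReal.add_thirds ε

end IsGlobalNPC

end Flow

/-! ### The maximal ergodic theorem and Birkhoff's theorem for bounded functions. -/

section Ergodic

variable {Ω : Type*} {T : Ω → Ω} {f : Ω → ℝ}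

/-- The maximum of `0` and the Birkhoff sums of length at most `n`. -/
noncomputable def maxBirkhoffSum (T : Ω → Ω) (f : Ω → ℝ) : ℕ → Ω → ℝ
  | 0 => fun _ => 0
  | n + 1 => fun ω => max 0 (f ω + maxBirkhoffSum T f n (T ω))

lemma maxBirkhoffSum_nonneg (T : Ω → Ω) (f : Ω → ℝ) (n : ℕ) (ω : Ω) :
    0 ≤ maxBirkhoffSum T f n ω := by
  cases n with
  | zero => exact le_rfl
  | succ n => exact le_max_left _ _

lemma maxBirkhoffSum_le_succ (T : Ω → Ω) (f : Ω → ℝ) (n : ℕ) (ω : Ω) :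
    maxBirkhoffSum T f n ω ≤ maxBirkhoffSum T f (n + 1) ω := by
  induction n generalizing ω with
  | zero => exact maxBirkhoffSum_nonneg T f 1 ω
  | succ n ih => exact max_le_max le_rfl (add_le_add le_rfl (ih (T ω)))

lemma birkhoffSum_le_maxBirkhoffSum (T : Ω → Ω) (f : Ω → ℝ) (n : ℕ) (ω : Ω) :
    birkhoffSum T f n ω ≤ maxBirkhoffSum T f n ω := by
  induction n generalizing ω with
  | zero => simp [maxBirkhoffSum]
  | succ n ih =>
    rw [birkhoffSum_succ']
    exact (add_le_add le_rfl (ih (T ω))).trans (le_max_right _ _)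

lemma maxBirkhoffSum_le_of_pos {n : ℕ} {ω : Ω} (h : 0 < maxBirkhoffSum T f n ω) :
    maxBirkhoffSum T f n ω ≤ f ω + maxBirkhoffSum T f n (T ω) := by
  cases n with
  | zero => exact absurd h (lt_irrefl (0 : ℝ))
  | succ n =>
    rcases lt_max_iff.1 h with h' | h'
    · exact absurd h' (lt_irrefl 0)
    · exact (le_of_eq (max_eq_right h'.le)).trans
        (add_le_add le_rfl (maxBirkhoffSum_le_succ T f n _))

/-- The points at which some subsequence of the Birkhoff averages stays away from `[a, ∞)`. -/
def birkhoffLowSet (T : Ω → Ω) (f : Ω → ℝ) (a : ℝ) : Set Ω :=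
  {ω | ∃ q : ℚ, (q : ℝ) < a ∧ ∃ᶠ n in atTop, birkhoffAverage ℝ T f n ω < q}

/-- The rational strictly below `a` leaves room for an `o(1)` change of the averages. This makes the
low sets exactly invariant, so that `P` may be restricted to them. -/
lemma mem_birkhoffLowSet_of_tendsto_sub {ω ω' : Ω} {a : ℝ}
    (h : Tendsto (fun n => birkhoffAverage ℝ T f n ω' - birkhoffAverage ℝ T f n ω) atTop (𝓝 0))
    (hω : ω ∈ birkhoffLowSet T f a) : ω' ∈ birkhoffLowSet T f a := by
  obtain ⟨q, hqa, hq⟩ := hω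
  obtain ⟨r, hqr, hra⟩ := exists_rat_btwn hqa
  refine ⟨r, hra, ?_⟩
  have h1 := h.eventually (gt_mem_nhds (sub_pos.2 hqr))
  exact (hq.and_eventually h1).mono fun n hn => by linarith [hn.1, hn.2]

lemma preimage_birkhoffLowSet (hf : ∃ C, ∀ ω, |f ω| ≤ C) (a : ℝ) :
    T ⁻¹' birkhoffLowSet T f a = birkhoffLowSet T f a := by
  obtain ⟨C, hC⟩ := hf
  have hb : Bornology.IsBounded (range f) :=
    isBounded_iff_forall_norm_le.2 ⟨C, forall_mem_range.2 hC⟩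
  ext ω
  have h : Tendsto (fun n => birkhoffAverage ℝ T f n (T ω) - birkhoffAverage ℝ T f n ω)
      atTop (𝓝 0) := tendsto_birkhoffAverage_apply_sub_birkhoffAverage' ℝ hb T ω
  refine ⟨mem_birkhoffLowSet_of_tendsto_sub ?_, mem_birkhoffLowSet_of_tendsto_sub h⟩
  simpa using h.neg

lemma exists_birkhoffSum_pos_of_mem_birkhoffLowSet {ω : Ω} {a : ℝ}
    (hω : ω ∈ birkhoffLowSet T f a) : ∃ n, 0 < birkhoffSum T (fun ω => a - f ω) n ω := by
  obtain ⟨q, hqa, hq⟩ := hω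
  obtain ⟨n, hn, hn0⟩ := (hq.and_eventually (eventually_gt_atTop 0)).exists
  refine ⟨n, ?_⟩
  have hn' : (0 : ℝ) < n := by exact_mod_cast hn0
  have h1 : birkhoffSum T f n ω < n * q := by
    rw [birkhoffAverage, smul_eq_mul, inv_mul_lt_iff₀ hn'] at hn
    exact hn
  have h2 : birkhoffSum T (fun ω => a - f ω) n ω = n * a - birkhoffSum T f n ω := by
    simp [birkhoffSum, Finset.sum_sub_distrib]
  rw [h2]
  nlinarith

variable [MeasurableSpace Ω] {P : Measure Ω}

lemma measurable_maxBirkhoffSum (hT : Measurable T) (hf : Measurable f) (n : ℕ) :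
    Measurable (maxBirkhoffSum T f n) := by
  induction n with
  | zero => exact measurable_const
  | succ n ih => exact measurable_const.max (hf.add (ih.comp hT))

lemma integrable_maxBirkhoffSum (hT : MeasurePreserving T P P) (hf : Integrable f P) (n : ℕ) :
    Integrable (maxBirkhoffSum T f n) P := by
  induction n with
  | zero => exact integrable_zero _ _ _
  | succ n ih => exact (integrable_zero _ _ _).sup (hf.add (hT.integrable_comp_of_integrable ih))

/-- Garsia's argument: integrate `m ≤ f + m ∘ T` over `{m > 0}`. There `m` has its full integral,
while that of `m ∘ T` is at most `∫ m` by invariance. -/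
lemma setIntegral_maxBirkhoffSum_pos_nonneg (hT : MeasurePreserving T P P) (hfm : Measurable f)
    (hf : Integrable f P) (n : ℕ) : 0 ≤ ∫ ω in {ω | 0 < maxBirkhoffSum T f n ω}, f ω ∂P := by
  set m := maxBirkhoffSum T f n with hm
  have hmeas : Measurable m := measurable_maxBirkhoffSum hT.measurable hfm n
  have hint : Integrable m P := integrable_maxBirkhoffSum hT hf n
  have hintT : Integrable (fun ω => m (T ω)) P := hT.integrable_comp_of_integrable hint
  have hE : MeasurableSet {ω | 0 < m ω} := measurableSet_lt measurable_const hmeas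
  have h1 : ∫ ω in {ω | 0 < m ω}, m ω ∂P = ∫ ω, m ω ∂P := by
    refine setIntegral_eq_integral_of_forall_compl_eq_zero fun ω hω => ?_
    exact le_antisymm (not_lt.1 hω) (maxBirkhoffSum_nonneg T f n ω)
  have h2 : ∫ ω in {ω | 0 < m ω}, m (T ω) ∂P ≤ ∫ ω, m ω ∂P := by
    have e : ∫ ω, m (T ω) ∂P = ∫ ω, m ω ∂P := by
      conv_rhs => rw [← hT.map_eq]
      exact (integral_map hT.aemeasurable hmeas.aestronglyMeasurable).symm
    rw [← e]
    exact setIntegral_le_integral hintT (.of_forall fun ω => maxBirkhoffSum_nonneg T f n _)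
  have h3 : ∫ ω in {ω | 0 < m ω}, m ω ∂P ≤ ∫ ω in {ω | 0 < m ω}, (f ω + m (T ω)) ∂P := by
    refine setIntegral_mono_on hint.integrableOn (hf.add hintT).integrableOn hE fun ω hω => ?_
    exact maxBirkhoffSum_le_of_pos hω
  rw [integral_add hf.integrableOn hintT.integrableOn] at h3
  linarith

/-- The maximal ergodic theorem. -/
theorem setIntegral_maximal_nonneg (hT : MeasurePreserving T P P) (hfm : Measurable f)
    (hf : Integrable f P) : 0 ≤ ∫ ω in {ω | ∃ n, 0 < maxBirkhoffSum T f n ω}, f ω ∂P := by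
  rw [ofPred_exists]
  refine ge_of_tendsto' (tendsto_setIntegral_of_monotone (fun n => ?_) ?_ hf.integrableOn)
    (setIntegral_maxBirkhoffSum_pos_nonneg hT hfm hf)
  · exact measurableSet_lt measurable_const (measurable_maxBirkhoffSum hT.measurable hfm n)
  · exact monotone_nat_of_le_succ fun n ω hω => lt_of_lt_of_le hω (maxBirkhoffSum_le_succ T f n ω)

/-- If every orbit has a positive Birkhoff sum then the integral is nonnegative. -/
lemma integral_nonneg_of_exists_birkhoffSum_pos (hT : MeasurePreserving T P P)
    (hfm : Measurable f) (hf : Integrable f P) (h : ∀ᵐ ω ∂P, ∃ n, 0 < birkhoffSum T f n ω) :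
    0 ≤ ∫ ω, f ω ∂P := by
  have h1 := setIntegral_maximal_nonneg hT hfm hf
  rwa [setIntegral_eq_integral_of_ae_compl_eq_zero] at h1
  filter_upwards [h] with ω ⟨n, hn⟩ hω
  exact absurd ⟨n, hn.trans_le (birkhoffSum_le_maxBirkhoffSum T f n ω)⟩ hω

/-- The maximal inequality for Birkhoff averages of a nonnegative function. -/
theorem measure_exists_lt_birkhoffSum_le [IsFiniteMeasure P] (hT : MeasurePreserving T P P)
    (hfm : Measurable f) (hf : Integrable f P) (hf0 : 0 ≤ f) {c : ℝ} (hc : 0 < c) :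
    P {ω | ∃ n : ℕ, n * c < birkhoffSum T f n ω} ≤ ENNReal.ofReal ((∫ ω, f ω ∂P) / c) := by
  set g : Ω → ℝ := fun ω => f ω - c
  have hgm : Measurable g := hfm.sub_const c
  have hg : Integrable g P := hf.sub (integrable_const c)
  set E := {ω | ∃ n, 0 < maxBirkhoffSum T g n ω}
  have hE : MeasurableSet E := by
    rw [show E = ⋃ n, {ω | 0 < maxBirkhoffSum T g n ω} from ofPred_exists _]
    exact .iUnion fun n =>
      measurableSet_lt measurable_const (measurable_maxBirkhoffSum hT.measurable hgm n)
  have h1 : 0 ≤ ∫ ω in E, g ω ∂P := setIntegral_maximal_nonneg hT hgm hg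
  have h2 : ∫ ω in E, g ω ∂P = ∫ ω in E, f ω ∂P - P.real E * c := by
    rw [integral_sub hf.integrableOn (integrable_const c)]
    simp
  have h3 : ∫ ω in E, f ω ∂P ≤ ∫ ω, f ω ∂P := setIntegral_le_integral hf (.of_forall hf0)
  have h4 : P.real E ≤ (∫ ω, f ω ∂P) / c := by
    rw [le_div_iff₀ hc]
    linarith
  refine (measure_mono ?_).trans ((ENNReal.ofReal_toReal (measure_ne_top P E)).ge.trans
    (ENNReal.ofReal_le_ofReal h4))
  rintro ω ⟨n, hn⟩
  refine ⟨n, lt_of_lt_of_le ?_ (birkhoffSum_le_maxBirkhoffSum T g n ω)⟩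
  simp only [birkhoffSum, g, Finset.sum_sub_distrib] at hn ⊢
  simpa using hn

lemma measurable_birkhoffAverage (hT : Measurable T) (hf : Measurable f) (n : ℕ) :
    Measurable (birkhoffAverage ℝ T f n) := by
  unfold birkhoffAverage birkhoffSum
  exact (Finset.measurable_sum _ fun k _ => hf.comp (hT.iterate k)).const_smul (n : ℝ)⁻¹

lemma measurableSet_birkhoffLowSet (hT : Measurable T) (hf : Measurable f) (a : ℝ) :
    MeasurableSet (birkhoffLowSet T f a) := by
  have : birkhoffLowSet T f a = ⋃ q : ℚ, ⋃ _ : (q : ℝ) < a,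
      ⋂ N : ℕ, ⋃ n : ℕ, ⋃ _ : N ≤ n, {ω | birkhoffAverage ℝ T f n ω < q} := by
    ext ω
    simp [birkhoffLowSet, frequently_atTop]
  rw [this]
  refine .iUnion fun q => .iUnion fun _ => .iInter fun N => .iUnion fun n => .iUnion fun _ => ?_
  exact measurableSet_lt (measurable_birkhoffAverage hT hf n) measurable_const

/-- Birkhoff's pointwise ergodic theorem for bounded functions. -/
theorem ae_exists_tendsto_birkhoffAverage [IsFiniteMeasure P] (hT : MeasurePreserving T P P)
    (hfm : Measurable f) (hf : ∃ C, ∀ ω, |f ω| ≤ C) :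
    ∀ᵐ ω ∂P, ∃ l, Tendsto (fun n => birkhoffAverage ℝ T f n ω) atTop (𝓝 l) := by
  have hfn : ∃ C, ∀ ω, |(-f) ω| ≤ C := by simpa using hf
  -- On the invariant set `E` the averages drop below `a` and rise above `b` infinitely often. The
  -- maximal theorem for `a - f` and `f - b` on `E` yields `b P(E) ≤ ∫_E f ≤ a P(E)`, so `P(E) = 0`.
  have key : ∀ a b : ℝ, a < b →
      P (birkhoffLowSet T f a ∩ birkhoffLowSet T (-f) (-b)) = 0 := by
    intro a b hab
    set E := birkhoffLowSet T f a ∩ birkhoffLowSet T (-f) (-b)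
    have hE : MeasurableSet E := (measurableSet_birkhoffLowSet hT.measurable hfm a).inter
      (measurableSet_birkhoffLowSet hT.measurable hfm.neg (-b))
    have hTE : MeasurePreserving T (P.restrict E) (P.restrict E) := by
      have h := hT.restrict_preimage hE
      rwa [preimage_inter, preimage_birkhoffLowSet hf, preimage_birkhoffLowSet hfn] at h
    have hfi : Integrable f (P.restrict E) := by
      obtain ⟨C, hC⟩ := hf
      exact Integrable.of_bound hfm.aestronglyMeasurable C (.of_forall hC)
    have h1 : 0 ≤ ∫ ω in E, (a - f ω) ∂P :=
      integral_nonneg_of_exists_birkhoffSum_pos hTE (measurable_const.sub hfm)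
        ((integrable_const a).sub hfi) ((ae_restrict_mem hE).mono fun ω hω =>
          exists_birkhoffSum_pos_of_mem_birkhoffLowSet hω.1)
    have h2 : 0 ≤ ∫ ω in E, (-b - (-f) ω) ∂P :=
      integral_nonneg_of_exists_birkhoffSum_pos hTE (measurable_const.sub hfm.neg)
        ((integrable_const (-b)).sub hfi.neg) ((ae_restrict_mem hE).mono fun ω hω =>
          exists_birkhoffSum_pos_of_mem_birkhoffLowSet hω.2)
    rw [integral_sub (integrable_const _) hfi] at h1
    rw [integral_sub (integrable_const _) hfi.neg] at h2
    simp only [integral_const, smul_eq_mul, measureReal_restrict_apply_univ, Pi.neg_apply,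
      integral_neg] at h1 h2
    have h3 : P.real E ≤ 0 := by nlinarith
    rwa [← measureReal_eq_zero_iff, ← measureReal_nonneg.ge_iff_eq']
  have hall : ∀ᵐ ω ∂P, ∀ a b : ℚ, (a : ℝ) < b →
      ω ∉ birkhoffLowSet T f a ∩ birkhoffLowSet T (-f) (-b) := by
    rw [ae_all_iff]
    intro a
    rw [ae_all_iff]
    intro b
    by_cases hab : (a : ℝ) < b
    · filter_upwards [measure_eq_zero_iff_ae_notMem.1 (key a b hab)] with ω hω _ using hω
    · exact .of_forall fun ω h => absurd h hab
  filter_upwards [hall] with ω hω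
  obtain ⟨C, hC⟩ := hf
  have hbd : ∀ n, |birkhoffAverage ℝ T f n ω| ≤ C := by
    intro n
    rcases Nat.eq_zero_or_pos n with rfl | hn
    · simpa using (abs_nonneg _).trans (hC ω)
    · have hn' : (0 : ℝ) < n := by exact_mod_cast hn
      rw [birkhoffAverage, smul_eq_mul, abs_mul, abs_inv, Nat.abs_cast, inv_mul_le_iff₀ hn']
      refine (Finset.abs_sum_le_sum_abs _ _).trans ((Finset.sum_le_sum fun k _ => hC _).trans ?_)
      simp
  refine tendsto_of_no_upcrossings (s := range ((↑) : ℚ → ℝ)) Rat.isDenseEmbedding_coe_real.dense ?_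
    (isBoundedUnder_of ⟨C, fun n => (abs_le.1 (hbd n)).2⟩)
    (isBoundedUnder_of ⟨-C, fun n => (abs_le.1 (hbd n)).1⟩)
  rintro _ ⟨a, rfl⟩ _ ⟨b, rfl⟩ hab ⟨h1, h2⟩
  -- The low sets require levels strictly inside `(a, b)`: the witnesses are `a < a'` and `-b <
  -- -b'`.
  obtain ⟨a', ha, ha'⟩ := exists_rat_btwn hab
  obtain ⟨b', hb, hb'⟩ := exists_rat_btwn ha'
  refine hω a' b' hb ⟨⟨a, ha, h1⟩, -b, by simpa using hb', ?_⟩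
  refine h2.mono fun n hn => ?_
  have : birkhoffAverage ℝ T (-f) n ω = -birkhoffAverage ℝ T f n ω := by
    simp [birkhoffAverage, birkhoffSum]
  rw [this]
  push_cast
  linarith

end Ergodic

/-! ### Empirical measures and their distances. -/

section Empirical

variable {M : Type*}

/-- The uniform probability measure on `{0, …, n-1}`. -/
noncomputable def uniformNat (n : ℕ) : Measure ℕ :=
  (n : ℝ≥0∞)⁻¹ • ∑ k ∈ Finset.range n, Measure.dirac k

lemma lintegral_uniformNat (n : ℕ) (f : ℕ → ℝ≥0∞) :
    ∫⁻ k, f k ∂uniformNat n = (n : ℝ≥0∞)⁻¹ * ∑ k ∈ Finset.range n, f k := by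
  simp [uniformNat, lintegral_smul_measure]

lemma isProbabilityMeasure_uniformNat {n : ℕ} (hn : n ≠ 0) :
    IsProbabilityMeasure (uniformNat n) := by
  refine ⟨?_⟩
  have := lintegral_uniformNat n 1
  simp only [Pi.one_apply, lintegral_const, one_mul, Finset.sum_const, Finset.card_range,
    nsmul_eq_mul, mul_one] at this
  rw [this, ENNReal.inv_mul_cancel (by exact_mod_cast hn) (ENNReal.natCast_ne_top n)]

section

variable {Ω : Type*} [MeasurableSpace M]

/-- Parametrizing by time makes every orbit map measurable and couples two empirical measures
through the common time index. -/
lemma empiricalMeasure_eq_map (T : Ω → Ω) (φ : Ω → M) (n : ℕ) (ω : Ω) :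
    empiricalMeasure T φ n ω = (uniformNat n).map fun k => φ (T^[k] ω) := by
  ext s hs
  rw [Measure.map_apply (measurable_of_countable _) hs]
  simp only [empiricalMeasure, uniformNat, Measure.smul_apply, Measure.coe_finsetSum,
    Finset.sum_apply]
  congr 1
  refine Finset.sum_congr rfl fun k _ => ?_
  rw [Measure.dirac_apply' _ hs, Measure.dirac_apply]
  rfl

lemma empiricalMeasure_simpleFunc [MeasurableSpace Ω] (T : Ω → Ω)
    (ψ : SimpleFunc Ω M) {n : ℕ} (hn : n ≠ 0) (ω : Ω) :
    empiricalMeasure T ψ n ω = ∑ x ∈ ψ.range,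
      ENNReal.ofReal (birkhoffAverage ℝ T ((ψ ⁻¹' {x}).indicator 1) n ω) • Measure.dirac x := by
  classical
  have hn' : (0 : ℝ) < n := by exact_mod_cast Nat.pos_of_ne_zero hn
  have h1 : ∀ x : M, ENNReal.ofReal (birkhoffAverage ℝ T ((ψ ⁻¹' {x}).indicator 1) n ω) =
      (n : ℝ≥0∞)⁻¹ * ∑ k ∈ Finset.range n, if ψ (T^[k] ω) = x then 1 else 0 := by
    intro x
    have hind : ∀ ω, 0 ≤ (ψ ⁻¹' {x}).indicator (1 : Ω → ℝ) ω :=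
      indicator_nonneg fun _ _ => zero_le_one
    rw [birkhoffAverage, smul_eq_mul, ENNReal.ofReal_mul (by positivity),
      ENNReal.ofReal_inv_of_pos hn', ENNReal.ofReal_natCast, birkhoffSum,
      ENNReal.ofReal_sum_of_nonneg fun k _ => hind _]
    congr 1
    refine Finset.sum_congr rfl fun k _ => ?_
    simp only [indicator, mem_preimage, mem_singleton_iff, Pi.one_apply]
    split_ifs <;> simp
  simp only [h1, empiricalMeasure, ← smul_smul, ← Finset.smul_sum, Finset.sum_smul]
  congr 1
  rw [Finset.sum_comm]
  refine Finset.sum_congr rfl fun k _ => ?_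
  simp

end

variable [MetricSpace M] [MeasurableSpace M]

lemma wasserstein1_map_uniformNat_le (n : ℕ) (u v : ℕ → M) :
    wasserstein1 ((uniformNat n).map u) ((uniformNat n).map v) ≤
      (n : ℝ≥0∞)⁻¹ * ∑ k ∈ Finset.range n, edist (u k) (v k) := by
  rw [← lintegral_uniformNat n fun k => edist (u k) (v k)]
  exact wasserstein1_map_map_le _ (measurable_of_countable _) (measurable_of_countable _)

/-- The largest distance between the images of two measures under contractive barycentric maps. -/
noncomputable def contractiveDist (μ ν : Measure M) : ℝ≥0∞ :=
  ⨆ (α : Measure M → M) (_ : IsContractiveBarycentricMap α), edist (α μ) (α ν)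

lemma IsContractiveBarycentricMap.edist_le_contractiveDist {α : Measure M → M}
    (hα : IsContractiveBarycentricMap α) (μ ν : Measure M) :
    edist (α μ) (α ν) ≤ contractiveDist μ ν :=
  le_iSup₂ (f := fun (α : Measure M → M) (_ : IsContractiveBarycentricMap α) =>
    edist (α μ) (α ν)) α hα

lemma contractiveDist_le_wasserstein1 {μ ν : Measure M} (hμ : μ ∈ P1 M) (hν : ν ∈ P1 M) :
    contractiveDist μ ν ≤ wasserstein1 μ ν :=
  iSup₂_le fun _ hα => hα.2 _ hμ _ hν

variable [BorelSpace M]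

lemma map_uniformNat_mem_P1 {n : ℕ} (hn : n ≠ 0) (u : ℕ → M) :
    (uniformNat n).map u ∈ P1 M := by
  have := isProbabilityMeasure_uniformNat hn
  refine map_mem_P1 ⟨StronglyMeasurable.of_discrete.aestronglyMeasurable, u 0, ?_⟩
  rw [lintegral_uniformNat]
  exact ENNReal.mul_lt_top (ENNReal.inv_lt_top.2 (by exact_mod_cast Nat.pos_of_ne_zero hn))
    (ENNReal.sum_lt_top.2 fun k _ => edist_lt_top _ _)

lemma IsContractiveBarycentricMap.edist_map_uniformNat_le {α : Measure M → M}
    (hα : IsContractiveBarycentricMap α) (n : ℕ) (u v : ℕ → M) :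
    edist (α ((uniformNat n).map u)) (α ((uniformNat n).map v)) ≤
      (n : ℝ≥0∞)⁻¹ * ∑ k ∈ Finset.range n, edist (u k) (v k) := by
  rcases eq_or_ne n 0 with rfl | hn
  · simp [uniformNat]
  · exact (hα.2 _ (map_uniformNat_mem_P1 hn u) _ (map_uniformNat_mem_P1 hn v)).trans
      (wasserstein1_map_uniformNat_le n u v)

variable {Ω : Type*} {T : Ω → Ω}

lemma empiricalMeasure_mem_P1 (T : Ω → Ω) (φ : Ω → M) {n : ℕ} (hn : n ≠ 0) (ω : Ω) :
    empiricalMeasure T φ n ω ∈ P1 M := by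
  rw [empiricalMeasure_eq_map]
  exact map_uniformNat_mem_P1 hn _

lemma IsContractiveBarycentricMap.edist_empiricalMeasure_le {α : Measure M → M}
    (hα : IsContractiveBarycentricMap α) (T : Ω → Ω) (φ ψ : Ω → M) (n : ℕ) (ω : Ω) :
    edist (α (empiricalMeasure T φ n ω)) (α (empiricalMeasure T ψ n ω)) ≤
      (n : ℝ≥0∞)⁻¹ * ∑ k ∈ Finset.range n, edist (φ (T^[k] ω)) (ψ (T^[k] ω)) := by
  rw [empiricalMeasure_eq_map, empiricalMeasure_eq_map]
  exact hα.edist_map_uniformNat_le n _ _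

lemma IsContractiveBarycentricMap.edist_empiricalMeasure_const_le {α : Measure M → M}
    (hα : IsContractiveBarycentricMap α) (T : Ω → Ω) (φ : Ω → M) (x : M) {n : ℕ} (hn : n ≠ 0)
    (ω : Ω) : edist (α (empiricalMeasure T φ n ω)) x ≤
      (n : ℝ≥0∞)⁻¹ * ∑ k ∈ Finset.range n, edist (φ (T^[k] ω)) x := by
  have h := hα.edist_empiricalMeasure_le T φ (fun _ => x) n ω
  have := isProbabilityMeasure_uniformNat hn
  rwa [empiricalMeasure_eq_map T fun _ => x, Measure.map_const, measure_univ, one_smul,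
    hα.1] at h

variable [MeasurableSpace Ω] {P : Measure Ω}

/-- The atoms lie in the finite range of `ψ` and their weights are Birkhoff averages of indicators,
which converge almost everywhere. -/
lemma ae_tendsto_wasserstein1_empiricalMeasure_simpleFunc [IsFiniteMeasure P]
    (hT : MeasurePreserving T P P) (ψ : SimpleFunc Ω M) :
    ∀ᵐ ω ∂P, Tendsto (fun p : ℕ × ℕ =>
      wasserstein1 (empiricalMeasure T ψ p.1 ω) (empiricalMeasure T ψ p.2 ω))
      (atTop ×ˢ atTop) (𝓝 0) := by
  rcases isEmpty_or_nonempty M with hM | ⟨⟨z⟩⟩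
  · exact .of_forall fun ω => (hM.false (ψ ω)).elim
  have h : ∀ x : M, ∀ᵐ ω ∂P, ∃ l, Tendsto
      (fun n => birkhoffAverage ℝ T ((ψ ⁻¹' {x}).indicator (1 : Ω → ℝ)) n ω) atTop (𝓝 l) := by
    intro x
    have hm : Measurable ((ψ ⁻¹' {x}).indicator (1 : Ω → ℝ)) :=
      measurable_one.indicator (ψ.measurableSet_preimage _)
    refine ae_exists_tendsto_birkhoffAverage hT hm ⟨1, fun ω => ?_⟩
    by_cases h : ω ∈ ψ ⁻¹' {x}
    · rw [indicator_of_mem h]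
      simp
    · rw [indicator_of_notMem h]
      simp
  have hall := (Finset.eventually_all ψ.range (l := ae P)).2 fun x _ => h x
  filter_upwards [hall] with ω hω
  set a : ℕ → M → ℝ := fun n x => birkhoffAverage ℝ T ((ψ ⁻¹' {x}).indicator 1) n ω with ha
  have hlim : Tendsto (fun p : ℕ × ℕ =>
      ∑ x ∈ ψ.range, ENNReal.ofReal (a p.1 x - a p.2 x) * edist z x +
      ∑ x ∈ ψ.range, ENNReal.ofReal (a p.2 x - a p.1 x) * edist z x)
      (atTop ×ˢ atTop) (𝓝 0) := by
    have h0 : ∀ x ∈ ψ.range, Tendsto (fun p : ℕ × ℕ => a p.1 x - a p.2 x)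
        (atTop ×ˢ atTop) (𝓝 0) := by
      intro x hx
      obtain ⟨l, hl⟩ := hω x hx
      simpa using (hl.comp tendsto_fst).sub (hl.comp tendsto_snd)
    have h1 : ∀ b : ℕ × ℕ → M → ℝ, (∀ x ∈ ψ.range, Tendsto (fun p => b p x)
        (atTop ×ˢ atTop) (𝓝 0)) → Tendsto (fun p => ∑ x ∈ ψ.range,
        ENNReal.ofReal (b p x) * edist z x) (atTop ×ˢ atTop) (𝓝 0) := by
      intro b hb
      rw [← Finset.sum_const_zero (s := ψ.range)]
      refine tendsto_finsetSum _ fun x hx => ?_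
      have := ENNReal.Tendsto.mul_const (b := edist z x)
        (ENNReal.tendsto_ofReal (hb x hx)) (Or.inr (edist_ne_top z x))
      simpa using this
    rw [← add_zero (0 : ℝ≥0∞)]
    refine (h1 _ h0).add (h1 (fun p x => a p.2 x - a p.1 x) fun x hx => ?_)
    simpa using (h0 x hx).neg
  refine tendsto_of_tendsto_of_tendsto_of_le_of_le' tendsto_const_nhds hlim
    (.of_forall fun _ => zero_le) ?_
  filter_upwards [(eventually_ne_atTop 0).prod_mk (eventually_ne_atTop 0)] with p hp
  have hmass : ∀ n ≠ 0, ∑ x ∈ ψ.range, ENNReal.ofReal (a n x) = 1 := by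
    intro n hn
    have := (empiricalMeasure_mem_P1 T ψ hn ω).1.measure_univ
    rw [empiricalMeasure_simpleFunc T ψ hn] at this
    simpa [Measure.coe_finsetSum, Finset.sum_apply] using this
  have hnn : ∀ n x, 0 ≤ a n x := fun n x => by
    rw [ha]
    simp only [birkhoffAverage, smul_eq_mul, birkhoffSum]
    exact mul_nonneg (by positivity)
      (Finset.sum_nonneg fun k _ => indicator_nonneg (fun _ _ => zero_le_one) _)
  rw [empiricalMeasure_simpleFunc T ψ hp.1, empiricalMeasure_simpleFunc T ψ hp.2]
  refine (wasserstein1_sum_dirac_le ψ.range (fun x => ENNReal.ofReal (a p.1 x))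
    (fun x => ENNReal.ofReal (a p.2 x)) (fun _ _ => ENNReal.ofReal_ne_top)
    (fun _ _ => ENNReal.ofReal_ne_top) ((hmass _ hp.1).trans (hmass _ hp.2).symm) z).trans
    (le_of_eq ?_)
  simp only [ENNReal.ofReal_sub _ (hnn _ _)]

lemma exists_simpleFunc_distL1_le {φ : Ω → M} (hφ : StronglyMeasurable φ) {x₀ : M}
    (hx₀ : ∫⁻ ω, edist x₀ (φ ω) ∂P < ∞) {ε : ℝ≥0∞} (hε : 0 < ε) :
    ∃ ψ : SimpleFunc Ω M, distL1 P φ ψ ≤ ε := by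
  have hsep : TopologicalSpace.IsSeparable (insert x₀ (range φ)) :=
    (countable_singleton x₀).isSeparable.union hφ.isSeparable_range
  have := hsep.separableSpace
  set ψ := SimpleFunc.approxOn φ hφ.measurable (insert x₀ (range φ)) x₀ (mem_insert _ _)
  have h : Tendsto (fun n => ∫⁻ ω, edist (φ ω) (ψ n ω) ∂P) atTop (𝓝 (∫⁻ _, 0 ∂P)) := by
    refine tendsto_lintegral_of_dominated_convergence (fun ω => edist x₀ (φ ω)) (fun n => ?_)
      (fun n => .of_forall fun ω => ?_) hx₀.ne (.of_forall fun ω => ?_)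
    · exact (hφ.edist (ψ n).stronglyMeasurable).measurable
    · simp only [edist_comm (φ ω)]
      exact SimpleFunc.edist_approxOn_le _ _ ω n
    · have h1 : Tendsto (fun n => ψ n ω) atTop (𝓝 (φ ω)) := SimpleFunc.tendsto_approxOn _ _
        (subset_closure (mem_insert_of_mem _ (mem_range_self ω)))
      simpa [edist_comm] using tendsto_iff_edist_tendsto_0.1 h1
  rw [lintegral_zero] at h
  obtain ⟨n, hn⟩ := (ENNReal.tendsto_nhds_zero.1 h ε hε).exists
  exact ⟨ψ n, hn⟩

end Empirical

lemma aestronglyMeasurable_fin_pi {Ω M : Type*} [MeasurableSpace Ω] [TopologicalSpace M]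
    {P : Measure Ω} {n : ℕ} {f : Fin n → Ω → M}
    (h : ∀ i, AEStronglyMeasurable (f i) P) : AEStronglyMeasurable (fun ω i => f i ω) P := by
  induction n with
  | zero =>
    have : (fun ω i => f i ω) = fun (_ : Ω) (i : Fin 0) => i.elim0 := by
      ext ω i
      exact i.elim0
    rw [this]
    exact aestronglyMeasurable_const
  | succ n ih =>
    have hcons : Continuous fun p : M × (Fin n → M) => (Fin.cons p.1 p.2 : Fin (n + 1) → M) :=
      continuous_pi fun i => by
        refine Fin.cases ?_ (fun i => ?_) i
        · simpa using continuous_fst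
        · simpa using (by fun_prop : Continuous fun p : M × (Fin n → M) => p.2 i)
    have h1 := hcons.comp_aestronglyMeasurable ((h 0).prodMk (ih fun i => h i.succ))
    refine h1.congr (.of_forall fun ω => ?_)
    ext i
    refine Fin.cases ?_ (fun i => ?_) i <;> simp

lemma ae_lt_uniformNat (n : ℕ) : ∀ᵐ k ∂uniformNat n, k < n := by
  refine Measure.ae_smul_measure ?_ _
  rw [ae_finsetSum_measure_iff]
  intro k hk
  rw [ae_dirac_eq]
  exact Finset.mem_range.1 hk

/-! ### Almost sure Cauchy property of the empirical measures. -/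

section ErgodicLimit

variable {M : Type*} [MetricSpace M] [MeasurableSpace M]

/-- Inherited from `M` for each `α`; for `wasserstein1` the same inequality would require gluing
couplings. -/
lemma contractiveDist_triangle (μ ν ρ : Measure M) :
    contractiveDist μ ρ ≤ contractiveDist μ ν + contractiveDist ν ρ :=
  iSup₂_le fun α hα => (edist_triangle (α μ) (α ν) (α ρ)).trans
    (add_le_add (hα.edist_le_contractiveDist μ ν) (hα.edist_le_contractiveDist ν ρ))

lemma contractiveDist_comm (μ ν : Measure M) : contractiveDist μ ν = contractiveDist ν μ := by
  simp only [contractiveDist, edist_comm]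

variable {α : Measure M → M}

lemma IsContractiveBarycentricMap.tendsto_ergodicLimit [Nonempty M] [CompleteSpace M]
    {Ω : Type*} {T : Ω → Ω} {φ : Ω → M} {ω : Ω} (hα : IsContractiveBarycentricMap α)
    (h : Tendsto (fun p : ℕ × ℕ =>
      contractiveDist (empiricalMeasure T φ p.1 ω) (empiricalMeasure T φ p.2 ω))
      (atTop ×ˢ atTop) (𝓝 0)) :
    Tendsto (fun n : ℕ => α (empiricalMeasure T φ n ω)) atTop (𝓝 (ergodicLimit T α φ ω)) := by
  have hc : CauchySeq fun n : ℕ => α (empiricalMeasure T φ n ω) := by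
    rw [EMetric.cauchySeq_iff]
    intro ε hε
    have h1 := h.eventually (gt_mem_nhds hε)
    rw [prod_atTop_atTop_eq, eventually_atTop_prod_self] at h1
    obtain ⟨N, hN⟩ := h1
    exact ⟨N, fun m hm n hn => (hα.edist_le_contractiveDist _ _).trans_lt (hN m n hm hn)⟩
  exact hc.tendsto_limUnder

variable [BorelSpace M] {Ω : Type*} [MeasurableSpace Ω] {P : Measure Ω} {T : Ω → Ω} {φ : Ω → M}

lemma ae_tendsto_contractiveDist_of_stronglyMeasurable [IsFiniteMeasure P]
    (hT : MeasurePreserving T P P) (hφ : StronglyMeasurable φ) {x₀ : M}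
    (hx₀ : ∫⁻ ω, edist x₀ (φ ω) ∂P < ∞) :
    ∀ᵐ ω ∂P, Tendsto (fun p : ℕ × ℕ =>
      contractiveDist (empiricalMeasure T φ p.1 ω) (empiricalMeasure T φ p.2 ω))
      (atTop ×ˢ atTop) (𝓝 0) := by
  -- With `L¹` error `δ²`, the maximal inequality at level `δ` gives a bad set of measure at most
  -- `δ`. These are summable, so by Borel–Cantelli almost every orbit has average error at most `δ
  -- j`, for all lengths `n` at once, once `j` is large.
  set δ : ℕ → ℝ := fun j => (1 / 2) ^ j with hδ
  have hδ0 : ∀ j, 0 < δ j := fun j => by positivity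
  have hex : ∀ j : ℕ, ∃ ψ : SimpleFunc Ω M, distL1 P φ ψ ≤ ENNReal.ofReal (δ j * δ j) := fun j =>
    exists_simpleFunc_distL1_le hφ hx₀ (by simpa using (mul_pos (hδ0 j) (hδ0 j)))
  choose ψ hψ using hex
  set g : ℕ → Ω → ℝ := fun j ω => dist (φ ω) (ψ j ω) with hg
  have hgm : ∀ j, Measurable (g j) := fun j => (hφ.dist (ψ j).stronglyMeasurable).measurable
  have hglint : ∀ j, ∫⁻ ω, ENNReal.ofReal (g j ω) ∂P ≤ ENNReal.ofReal (δ j * δ j) := fun j => by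
    simpa only [hg, ← edist_dist, distL1] using hψ j
  have hgi : ∀ j, Integrable (g j) P := fun j =>
    ⟨(hgm j).aestronglyMeasurable, by
      rw [hasFiniteIntegral_iff_ofReal (.of_forall fun ω => dist_nonneg)]
      exact (hglint j).trans_lt ENNReal.ofReal_lt_top⟩
  have hgint : ∀ j, ∫ ω, g j ω ∂P ≤ δ j * δ j := fun j => by
    rw [integral_eq_lintegral_of_nonneg_ae (.of_forall fun ω => dist_nonneg)
      (hgm j).aestronglyMeasurable]
    exact ENNReal.toReal_le_of_le_ofReal (mul_pos (hδ0 j) (hδ0 j)).le (hglint j)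
  have hB : ∀ j, P {ω | ∃ n : ℕ, n * δ j < birkhoffSum T (g j) n ω} ≤
      ENNReal.ofReal (δ j) := fun j => by
    refine (measure_exists_lt_birkhoffSum_le hT (hgm j) (hgi j) (fun ω => dist_nonneg)
      (hδ0 j)).trans (ENNReal.ofReal_le_ofReal ?_)
    rw [div_le_iff₀ (hδ0 j)]
    exact hgint j
  have hsum : ∑' j, P {ω | ∃ n : ℕ, n * δ j < birkhoffSum T (g j) n ω} ≠ ∞ := by
    refine ne_top_of_le_ne_top ?_ (ENNReal.tsum_le_tsum hB)
    rw [← ENNReal.ofReal_tsum_of_nonneg (fun j => (hδ0 j).le) summable_geometric_two]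
    exact ENNReal.ofReal_ne_top
  have hsimple : ∀ᵐ ω ∂P, ∀ j, Tendsto (fun p : ℕ × ℕ =>
      wasserstein1 (empiricalMeasure T (ψ j) p.1 ω) (empiricalMeasure T (ψ j) p.2 ω))
      (atTop ×ˢ atTop) (𝓝 0) :=
    ae_all_iff.2 fun j => ae_tendsto_wasserstein1_empiricalMeasure_simpleFunc hT (ψ j)
  filter_upwards [ae_eventually_notMem hsum, hsimple] with ω h1 h2
  rw [ENNReal.tendsto_nhds_zero]
  intro ε hε
  have hε3 : 0 < ε / 3 := ENNReal.div_pos hε.ne' (by simp)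
  have hδlim : Tendsto (fun j => ENNReal.ofReal (δ j)) atTop (𝓝 0) := by
    rw [← ENNReal.ofReal_zero]
    exact ENNReal.tendsto_ofReal
      (tendsto_pow_atTop_nhds_zero_of_lt_one (by norm_num) (by norm_num))
  obtain ⟨j, hj, hjε⟩ := (h1.and (ENNReal.tendsto_nhds_zero.1 hδlim _ hε3)).exists
  have happ : ∀ n ≠ 0, contractiveDist (empiricalMeasure T φ n ω)
      (empiricalMeasure T (ψ j) n ω) ≤ ε / 3 := by
    intro n hn
    have hn' : (0 : ℝ) < n := by exact_mod_cast Nat.pos_of_ne_zero hn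
    refine iSup₂_le fun α hα => (hα.edist_empiricalMeasure_le T φ (ψ j) n ω).trans
      (le_trans ?_ hjε)
    have h3 : birkhoffSum T (g j) n ω ≤ n * δ j := not_lt.1 fun h => hj ⟨n, h⟩
    have h4 : ∑ k ∈ Finset.range n, edist (φ (T^[k] ω)) (ψ j (T^[k] ω)) =
        ENNReal.ofReal (birkhoffSum T (g j) n ω) := by
      rw [birkhoffSum, ENNReal.ofReal_sum_of_nonneg fun k _ => dist_nonneg]
      simp only [edist_dist]
    rw [h4, ← ENNReal.ofReal_natCast, ← ENNReal.ofReal_inv_of_pos hn',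
      ← ENNReal.ofReal_mul (by positivity)]
    refine ENNReal.ofReal_le_ofReal ?_
    rwa [inv_mul_le_iff₀ hn']
  filter_upwards [ENNReal.tendsto_nhds_zero.1 (h2 j) _ hε3,
    (eventually_ne_atTop 0).prod_mk (eventually_ne_atTop 0)] with p hp hp0
  have h5 := (contractiveDist_le_wasserstein1 (empiricalMeasure_mem_P1 T (ψ j) hp0.1 ω)
    (empiricalMeasure_mem_P1 T (ψ j) hp0.2 ω)).trans hp
  have h6 := happ p.2 hp0.2
  rw [contractiveDist_comm] at h6
  calc _ ≤ _ := contractiveDist_triangle _ (empiricalMeasure T (ψ j) p.1 ω) _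
    _ ≤ _ := add_le_add le_rfl (contractiveDist_triangle _ (empiricalMeasure T (ψ j) p.2 ω) _)
    _ ≤ ε / 3 + (ε / 3 + ε / 3) := add_le_add (happ p.1 hp0.1) (add_le_add h5 h6)
    _ = ε := by rw [← add_assoc, ENNReal.add_thirds]

/-- Along almost every orbit the empirical measures form a Cauchy sequence, uniformly with respect
to all contractive barycentric maps. -/
theorem ae_tendsto_contractiveDist [IsFiniteMeasure P] (hT : MeasurePreserving T P P)
    (hφ : MemL1 P φ) :
    ∀ᵐ ω ∂P, Tendsto (fun p : ℕ × ℕ =>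
      contractiveDist (empiricalMeasure T φ p.1 ω) (empiricalMeasure T φ p.2 ω))
      (atTop ×ˢ atTop) (𝓝 0) := by
  obtain ⟨hm, x₀, hx₀⟩ := hφ
  have he := hm.ae_eq_mk
  have hx₀' : ∫⁻ ω, edist x₀ (hm.mk φ ω) ∂P < ∞ := by
    refine lt_of_le_of_lt (le_of_eq (lintegral_congr_ae ?_)) hx₀
    filter_upwards [he] with ω hω
    rw [hω]
  have hall : ∀ᵐ ω ∂P, ∀ k : ℕ, φ (T^[k] ω) = hm.mk φ (T^[k] ω) :=
    ae_all_iff.2 fun k => (hT.iterate k).quasiMeasurePreserving.ae he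
  filter_upwards [hall, ae_tendsto_contractiveDist_of_stronglyMeasurable hT
    hm.stronglyMeasurable_mk hx₀'] with ω h1 h2
  simpa only [empiricalMeasure, h1] using h2

/-- No measurability of `α` is assumed; contractivity makes its value on empirical measures a
continuous function of the `n` sample points. -/
lemma IsContractiveBarycentricMap.aestronglyMeasurable_empiricalMeasure
    (hα : IsContractiveBarycentricMap α) (hT : MeasurePreserving T P P)
    (hφ : AEStronglyMeasurable φ P) (n : ℕ) :
    AEStronglyMeasurable (fun ω => α (empiricalMeasure T φ n ω)) P := by
  rcases eq_or_ne n 0 with rfl | hn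
  · simp only [empiricalMeasure, Finset.range_zero, Finset.sum_empty, smul_zero]
    exact aestronglyMeasurable_const
  have : NeZero n := ⟨hn⟩
  -- `Fin.ofNat` wraps around modulo `n`, which is harmless because `uniformNat n` is carried by `k
  -- < n`.
  set G : (Fin n → M) → M := fun v => α ((uniformNat n).map fun k => v (Fin.ofNat n k)) with hG
  have hcont : Continuous G := by
    refine LipschitzWith.continuous (K := 1) fun v w => ?_
    refine (hα.edist_map_uniformNat_le n _ _).trans ?_
    calc (n : ℝ≥0∞)⁻¹ * ∑ k ∈ Finset.range n, edist (v (Fin.ofNat n k)) (w (Fin.ofNat n k))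
        ≤ (n : ℝ≥0∞)⁻¹ * ∑ k ∈ Finset.range n, edist v w := by
          gcongr
          exact edist_le_pi_edist v w _
      _ = (1 : NNReal) * edist v w := by
          rw [Finset.sum_const, Finset.card_range, nsmul_eq_mul, ← mul_assoc,
            ENNReal.inv_mul_cancel (by exact_mod_cast hn) (ENNReal.natCast_ne_top n)]
          simp
  have h1 := hcont.comp_aestronglyMeasurable (aestronglyMeasurable_fin_pi (n := n)
    (f := fun i ω => φ (T^[(i : ℕ)] ω)) fun i =>
      hφ.comp_measurePreserving (hT.iterate (i : ℕ)))
  refine h1.congr (.of_forall fun ω => ?_)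
  simp only [hG]
  rw [empiricalMeasure_eq_map]
  congr 1
  refine Measure.map_congr ((ae_lt_uniformNat n).mono fun k hk => ?_)
  simp [Nat.mod_eq_of_lt hk]

end ErgodicLimit

/-! ### Passing to the limit along a single orbit. -/

section Orbit

variable {M : Type*} [MetricSpace M] [MeasurableSpace M] [BorelSpace M] [Nonempty M]
  {α : Measure M → M} {Ω : Type*} {T : Ω → Ω} {φ : Ω → M}

/-- The pointwise ergodic limit of an integrable function is also bounded by the averages of its
distance to a base point. -/
lemma IsContractiveBarycentricMap.edist_ergodicLimit_le_liminf
    (hα : IsContractiveBarycentricMap α) (x : M) {ω : Ω}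
    (h : Tendsto (fun n : ℕ => α (empiricalMeasure T φ n ω)) atTop
      (𝓝 (ergodicLimit T α φ ω))) :
    edist (ergodicLimit T α φ ω) x ≤ liminf (fun n : ℕ =>
      (n : ℝ≥0∞)⁻¹ * ∑ k ∈ Finset.range n, edist (φ (T^[k] ω)) x) atTop := by
  rw [← (h.edist (tendsto_const_nhds (x := x))).liminf_eq]
  refine liminf_le_liminf ?_
  filter_upwards [eventually_ne_atTop 0] with n hn
  exact hα.edist_empiricalMeasure_const_le T φ x hn ω

/-- Convergence of contractive barycentric maps on `𝒫¹(M)` entails convergence of their ergodic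
limit functions along every orbit whose empirical measures form a Cauchy sequence. -/
theorem tendsto_ergodicLimit_of_tendsto [CompleteSpace M] {ι : Type*} {l : Filter ι} {κ : ι → Measure M → M}
    (hκ : ∀ᶠ i in l, IsContractiveBarycentricMap (κ i)) (hα : IsContractiveBarycentricMap α)
    (hlim : ∀ μ ∈ P1 M, Tendsto (fun i => κ i μ) l (𝓝 (α μ))) {ω : Ω}
    (h : Tendsto (fun p : ℕ × ℕ =>
      contractiveDist (empiricalMeasure T φ p.1 ω) (empiricalMeasure T φ p.2 ω))
      (atTop ×ˢ atTop) (𝓝 0)) :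
    Tendsto (fun i => ergodicLimit T (κ i) φ ω) l (𝓝 (ergodicLimit T α φ ω)) := by
  rw [tendsto_iff_edist_tendsto_0, ENNReal.tendsto_nhds_zero]
  intro ε hε
  have hε3 : 0 < ε / 3 := ENNReal.div_pos hε.ne' (by simp)
  have h1 := ENNReal.tendsto_nhds_zero.1 h _ hε3
  rw [prod_atTop_atTop_eq, eventually_atTop_prod_self] at h1
  obtain ⟨N₀, hN₀⟩ := h1
  set N := N₀ + 1
  -- The length `N` depends only on the orbit, not on `κ`; taking `N₀ + 1` keeps it nonzero.
  have hclose : ∀ κ : Measure M → M, IsContractiveBarycentricMap κ →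
      edist (ergodicLimit T κ φ ω) (κ (empiricalMeasure T φ N ω)) ≤ ε / 3 := by
    intro κ hκ
    refine le_of_tendsto ((hκ.tendsto_ergodicLimit h).edist
      (tendsto_const_nhds (x := κ (empiricalMeasure T φ N ω)))) ?_
    filter_upwards [eventually_ge_atTop N₀] with n hn
    exact (hκ.edist_le_contractiveDist _ _).trans (hN₀ n N hn (Nat.le_succ N₀))
  have h2 := tendsto_iff_edist_tendsto_0.1
    (hlim _ (empiricalMeasure_mem_P1 T φ (Nat.succ_ne_zero N₀) ω))
  filter_upwards [hκ, ENNReal.tendsto_nhds_zero.1 h2 _ hε3] with i hi hi2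
  have h3 := hclose α hα
  rw [edist_comm] at h3
  calc _ ≤ _ := edist_triangle4 _ (κ i (empiricalMeasure T φ N ω))
        (α (empiricalMeasure T φ N ω)) _
    _ ≤ ε / 3 + ε / 3 + ε / 3 := add_le_add (add_le_add (hclose _ hi) hi2) h3
    _ = ε := ENNReal.add_thirds ε

end Orbit

/-! ### Convergence in `L¹`. -/

section ErgodicLimit

variable {M : Type*} [MetricSpace M] {Ω : Type*} [MeasurableSpace Ω] {P : Measure Ω} {T : Ω → Ω}
  {φ ψ : Ω → M}

lemma distL1_comm (P : Measure Ω) (φ ψ : Ω → M) : distL1 P φ ψ = distL1 P ψ φ := by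
  simp only [distL1, edist_comm]

lemma distL1_triangle {χ : Ω → M} (hφ : AEStronglyMeasurable φ P) (hψ : AEStronglyMeasurable ψ P) :
    distL1 P φ χ ≤ distL1 P φ ψ + distL1 P ψ χ := by
  unfold distL1
  rw [← lintegral_add_left' (hφ.edist hψ)]
  exact lintegral_mono fun ω => edist_triangle _ _ _

/-- Fatou's lemma for the `L¹`-distance. -/
lemma distL1_le_of_tendsto_ae {u v : ℕ → Ω → M} {C : ℝ≥0∞}
    (hu : ∀ n, AEStronglyMeasurable (u n) P) (hv : ∀ n, AEStronglyMeasurable (v n) P)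
    (huφ : ∀ᵐ ω ∂P, Tendsto (fun n => u n ω) atTop (𝓝 (φ ω)))
    (hvψ : ∀ᵐ ω ∂P, Tendsto (fun n => v n ω) atTop (𝓝 (ψ ω)))
    (hC : ∀ᶠ n in atTop, distL1 P (u n) (v n) ≤ C) : distL1 P φ ψ ≤ C := by
  calc distL1 P φ ψ = ∫⁻ ω, liminf (fun n => edist (u n ω) (v n ω)) atTop ∂P := by
        refine lintegral_congr_ae ?_
        filter_upwards [huφ, hvψ] with ω h1 h2
        exact (h1.edist h2).liminf_eq.symm
    _ ≤ liminf (fun n => distL1 P (u n) (v n)) atTop :=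
        lintegral_liminf_le' fun n => (hu n).edist (hv n)
    _ ≤ C := liminf_le_of_frequently_le' hC.frequently

lemma lintegral_average_le (hT : MeasurePreserving T P P) {f : Ω → ℝ≥0∞} (hf : AEMeasurable f P)
    (n : ℕ) :
    ∫⁻ ω, (n : ℝ≥0∞)⁻¹ * ∑ k ∈ Finset.range n, f (T^[k] ω) ∂P ≤ ∫⁻ ω, f ω ∂P := by
  have h1 : ∀ k : ℕ, ∫⁻ ω, f (T^[k] ω) ∂P = ∫⁻ ω, f ω ∂P := fun k => by
    have hk := hT.iterate k
    conv_rhs => rw [← hk.map_eq]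
    exact (lintegral_map' (by rwa [hk.map_eq]) hk.aemeasurable).symm
  have h2 : ∀ k : ℕ, AEMeasurable (fun ω => f (T^[k] ω)) P := fun k =>
    hf.comp_quasiMeasurePreserving (hT.iterate k).quasiMeasurePreserving
  rw [lintegral_const_mul'' _ (Finset.aemeasurable_fun_sum _ fun k _ => h2 k),
    lintegral_finsetSum' _ fun k _ => h2 k]
  simp only [h1, Finset.sum_const, Finset.card_range, nsmul_eq_mul]
  rw [← mul_assoc]
  exact mul_le_of_le_one_left zero_le (ENNReal.inv_mul_le_one _)

/-- By Fatou and invariance. This liminf dominates the distance from `x` to the ergodic limit for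
every `α` and so serves as the majorant for the limit in `t`. -/
lemma lintegral_liminf_average_lt_top (hT : MeasurePreserving T P P)
    (hφ : AEStronglyMeasurable φ P) {x : M} (hx : ∫⁻ ω, edist x (φ ω) ∂P < ∞) :
    ∫⁻ ω, liminf (fun n : ℕ =>
      (n : ℝ≥0∞)⁻¹ * ∑ k ∈ Finset.range n, edist (φ (T^[k] ω)) x) atTop ∂P < ∞ := by
  have hf : AEMeasurable (fun ω => edist (φ ω) x) P := hφ.edist aestronglyMeasurable_const
  have hm : ∀ n : ℕ, AEMeasurable (fun ω =>
      (n : ℝ≥0∞)⁻¹ * ∑ k ∈ Finset.range n, edist (φ (T^[k] ω)) x) P := fun n =>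
    (Finset.aemeasurable_fun_sum _ fun k _ =>
      hf.comp_quasiMeasurePreserving (hT.iterate k).quasiMeasurePreserving).const_mul _
  refine (lintegral_liminf_le' hm).trans_lt (lt_of_le_of_lt ?_ hx)
  refine liminf_le_of_frequently_le' (Eventually.frequently (.of_forall fun n => ?_))
  refine (lintegral_average_le hT hf n).trans (le_of_eq ?_)
  simp only [edist_comm]

lemma memL1_simpleFunc [Nonempty M] [IsFiniteMeasure P] (ψ : SimpleFunc Ω M) : MemL1 P ψ := by
  obtain ⟨x⟩ := ‹Nonempty M›
  refine ⟨ψ.stronglyMeasurable.aestronglyMeasurable, x, ?_⟩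
  have hb : ∀ ω, edist x (ψ ω) ≤ ∑ y ∈ ψ.range, edist x y := fun ω =>
    Finset.single_le_sum (f := fun y => edist x y) (fun _ _ => zero_le) (ψ.mem_range_self ω)
  refine (lintegral_mono hb).trans_lt ?_
  rw [lintegral_const]
  exact ENNReal.mul_lt_top (ENNReal.sum_lt_top.2 fun _ _ => edist_lt_top _ _)
    (measure_lt_top _ _)

variable [MeasurableSpace M] [BorelSpace M] {α : Measure M → M}

lemma IsContractiveBarycentricMap.distL1_empiricalMeasure_le
    (hα : IsContractiveBarycentricMap α) (hT : MeasurePreserving T P P)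
    (hφ : AEStronglyMeasurable φ P) (hψ : AEStronglyMeasurable ψ P) (n : ℕ) :
    distL1 P (fun ω => α (empiricalMeasure T φ n ω)) (fun ω => α (empiricalMeasure T ψ n ω)) ≤
      distL1 P φ ψ :=
  (lintegral_mono fun ω => hα.edist_empiricalMeasure_le T φ ψ n ω).trans
    (lintegral_average_le hT (hφ.edist hψ) n)

lemma exists_simpleFunc_distL1_le_of_memL1 (hφ : MemL1 P φ) {ε : ℝ≥0∞} (hε : 0 < ε) :
    ∃ ψ : SimpleFunc Ω M, distL1 P φ ψ ≤ ε := by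
  obtain ⟨hm, x, hx⟩ := hφ
  have he := hm.ae_eq_mk
  have e1 : ∫⁻ ω, edist x (hm.mk φ ω) ∂P = ∫⁻ ω, edist x (φ ω) ∂P :=
    lintegral_congr_ae (he.mono fun ω h => by simp only [h])
  obtain ⟨ψ, hψ⟩ := exists_simpleFunc_distL1_le hm.stronglyMeasurable_mk (e1.trans_lt hx) hε
  refine ⟨ψ, le_of_eq_of_le (lintegral_congr_ae (he.mono fun ω h => ?_)) hψ⟩
  simp only [h]

variable [Nonempty M] [CompleteSpace M]

lemma IsContractiveBarycentricMap.ae_tendsto_ergodicLimit [IsFiniteMeasure P]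
    (hα : IsContractiveBarycentricMap α) (hT : MeasurePreserving T P P) (hφ : MemL1 P φ) :
    ∀ᵐ ω ∂P, Tendsto (fun n : ℕ => α (empiricalMeasure T φ n ω)) atTop
      (𝓝 (ergodicLimit T α φ ω)) :=
  (ae_tendsto_contractiveDist hT hφ).mono fun _ h => hα.tendsto_ergodicLimit h

lemma IsContractiveBarycentricMap.aestronglyMeasurable_ergodicLimit [IsFiniteMeasure P]
    (hα : IsContractiveBarycentricMap α) (hT : MeasurePreserving T P P) (hφ : MemL1 P φ) :
    AEStronglyMeasurable (ergodicLimit T α φ) P :=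
  aestronglyMeasurable_of_tendsto_ae atTop
    (hα.aestronglyMeasurable_empiricalMeasure hT hφ.1) (hα.ae_tendsto_ergodicLimit hT hφ)

lemma IsContractiveBarycentricMap.distL1_ergodicLimit_le [IsFiniteMeasure P]
    (hα : IsContractiveBarycentricMap α) (hT : MeasurePreserving T P P) (hφ : MemL1 P φ)
    (hψ : MemL1 P ψ) :
    distL1 P (ergodicLimit T α φ) (ergodicLimit T α ψ) ≤ distL1 P φ ψ :=
  distL1_le_of_tendsto_ae (hα.aestronglyMeasurable_empiricalMeasure hT hφ.1)
    (hα.aestronglyMeasurable_empiricalMeasure hT hψ.1) (hα.ae_tendsto_ergodicLimit hT hφ)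
    (hα.ae_tendsto_ergodicLimit hT hψ)
    (.of_forall fun n => hα.distL1_empiricalMeasure_le hT hφ.1 hψ.1 n)

lemma IsContractiveBarycentricMap.memL1_ergodicLimit [IsFiniteMeasure P]
    (hα : IsContractiveBarycentricMap α) (hT : MeasurePreserving T P P) (hφ : MemL1 P φ) :
    MemL1 P (ergodicLimit T α φ) := by
  obtain ⟨x, hx⟩ := hφ.2
  refine ⟨hα.aestronglyMeasurable_ergodicLimit hT hφ, x, ?_⟩
  refine lt_of_le_of_lt (lintegral_mono_ae ?_) (lintegral_liminf_average_lt_top hT hφ.1 hx)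
  filter_upwards [hα.ae_tendsto_ergodicLimit hT hφ] with ω h
  rw [edist_comm]
  exact hα.edist_ergodicLimit_le_liminf x h

/-- A simple function has bounded range, hence so do its barycentric averages, and dominated
convergence applies. The general case follows because averages and limits are both 1-Lipschitz in
`φ`. -/
lemma IsContractiveBarycentricMap.tendsto_distL1_simpleFunc [IsFiniteMeasure P]
    (hα : IsContractiveBarycentricMap α) (hT : MeasurePreserving T P P) (ψ : SimpleFunc Ω M) :
    Tendsto (fun n : ℕ => distL1 P (fun ω => α (empiricalMeasure T ψ n ω)) (ergodicLimit T α ψ))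
      atTop (𝓝 0) := by
  obtain ⟨x⟩ := ‹Nonempty M›
  have hψ : MemL1 P ψ := memL1_simpleFunc ψ
  set C := ∑ y ∈ ψ.range, edist y x
  have hC : C ≠ ∞ := ENNReal.sum_ne_top.2 fun _ _ => edist_ne_top _ _
  have hb : ∀ n ≠ 0, ∀ ω, edist (α (empiricalMeasure T ψ n ω)) x ≤ C := by
    intro n hn ω
    refine (hα.edist_empiricalMeasure_const_le T ψ x hn ω).trans ?_
    refine (mul_le_mul_right (Finset.sum_le_sum fun k _ => Finset.single_le_sum
      (f := fun y => edist y x) (fun _ _ => zero_le) (ψ.mem_range_self (T^[k] ω))) _).trans ?_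
    rw [Finset.sum_const, Finset.card_range, nsmul_eq_mul, ← mul_assoc]
    exact mul_le_of_le_one_left zero_le (ENNReal.inv_mul_le_one _)
  have hlim := hα.ae_tendsto_ergodicLimit hT hψ
  have h := tendsto_lintegral_filter_of_dominated_convergence' (μ := P) (l := atTop)
    (F := fun (n : ℕ) ω => edist (α (empiricalMeasure T ψ n ω)) (ergodicLimit T α ψ ω))
    (f := fun _ => 0) (fun _ => C + C)
    (.of_forall fun n => (hα.aestronglyMeasurable_empiricalMeasure hT hψ.1 n).edist
      (hα.aestronglyMeasurable_ergodicLimit hT hψ)) ?_ ?_ ?_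
  · simpa [distL1] using h
  · filter_upwards [eventually_ne_atTop 0] with n hn
    filter_upwards [hlim] with ω hω
    refine (edist_triangle_right _ _ x).trans (add_le_add (hb n hn ω) ?_)
    refine le_of_tendsto (hω.edist (tendsto_const_nhds (x := x))) ?_
    filter_upwards [eventually_ne_atTop 0] with m hm using hb m hm ω
  · rw [lintegral_const]
    exact ENNReal.mul_ne_top (ENNReal.add_ne_top.2 ⟨hC, hC⟩) (measure_ne_top _ _)
  · filter_upwards [hlim] with ω hω using tendsto_iff_edist_tendsto_0.1 hω

/-- The `L¹` ergodic theorem for contractive barycentric maps. -/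
theorem IsContractiveBarycentricMap.tendsto_distL1_ergodicLimit [IsFiniteMeasure P]
    (hα : IsContractiveBarycentricMap α) (hT : MeasurePreserving T P P) (hφ : MemL1 P φ) :
    Tendsto (fun n : ℕ => distL1 P (fun ω => α (empiricalMeasure T φ n ω)) (ergodicLimit T α φ))
      atTop (𝓝 0) := by
  rw [ENNReal.tendsto_nhds_zero]
  intro ε hε
  have hε3 : 0 < ε / 3 := ENNReal.div_pos hε.ne' (by simp)
  obtain ⟨ψ, hψε⟩ := exists_simpleFunc_distL1_le_of_memL1 hφ hε3
  have hψ : MemL1 P ψ := memL1_simpleFunc ψ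
  filter_upwards [ENNReal.tendsto_nhds_zero.1 (hα.tendsto_distL1_simpleFunc hT ψ) _ hε3] with n hn
  have m1 := hα.aestronglyMeasurable_empiricalMeasure hT hφ.1 n
  have m2 := hα.aestronglyMeasurable_empiricalMeasure hT hψ.1 n
  have m3 := hα.aestronglyMeasurable_ergodicLimit hT hψ
  have h1 := (hα.distL1_empiricalMeasure_le hT hφ.1 hψ.1 n).trans hψε
  have h2 := (hα.distL1_ergodicLimit_le hT hφ hψ).trans hψε
  rw [distL1_comm] at h2
  calc _ ≤ _ := distL1_triangle m1 m2
    _ ≤ _ := add_le_add le_rfl (distL1_triangle m2 m3)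
    _ ≤ ε / 3 + (ε / 3 + ε / 3) := add_le_add h1 (add_le_add hn h2)
    _ = ε := by rw [← add_assoc, ENNReal.add_thirds]

theorem IsContractiveBarycentricMap.isErgodicLimit [IsFiniteMeasure P]
    (hα : IsContractiveBarycentricMap α) (hT : MeasurePreserving T P P) (hφ : MemL1 P φ) :
    IsErgodicLimit P T α φ (ergodicLimit T α φ) :=
  ⟨hα.memL1_ergodicLimit hT hφ, hα.ae_tendsto_ergodicLimit hT hφ,
    hα.tendsto_distL1_ergodicLimit hT hφ⟩

theorem tendsto_distL1_ergodicLimit_of_tendsto [IsFiniteMeasure P] {ι : Type*} {l : Filter ι}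
    [l.IsCountablyGenerated] {κ : ι → Measure M → M}
    (hκ : ∀ᶠ i in l, IsContractiveBarycentricMap (κ i)) (hα : IsContractiveBarycentricMap α)
    (hlim : ∀ μ ∈ P1 M, Tendsto (fun i => κ i μ) l (𝓝 (α μ)))
    (hT : MeasurePreserving T P P) (hφ : MemL1 P φ) :
    Tendsto (fun i => distL1 P (ergodicLimit T (κ i) φ) (ergodicLimit T α φ)) l (𝓝 0) := by
  obtain ⟨x, hx⟩ := hφ.2
  have hc := ae_tendsto_contractiveDist hT hφ
  have hfin := lintegral_liminf_average_lt_top hT hφ.1 hx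
  set b : Ω → ℝ≥0∞ := fun ω => liminf (fun n : ℕ =>
      (n : ℝ≥0∞)⁻¹ * ∑ k ∈ Finset.range n, edist (φ (T^[k] ω)) x) atTop
  have h := tendsto_lintegral_filter_of_dominated_convergence' (μ := P) (l := l)
    (F := fun i ω => edist (ergodicLimit T (κ i) φ ω) (ergodicLimit T α φ ω))
    (f := fun _ => 0) (fun ω => 2 * b ω) ?_ ?_ ?_ ?_
  · simpa [distL1] using h
  · filter_upwards [hκ] with i hi
    exact (hi.aestronglyMeasurable_ergodicLimit hT hφ).edist
      (hα.aestronglyMeasurable_ergodicLimit hT hφ)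
  · filter_upwards [hκ] with i hi
    filter_upwards [hc] with ω hω
    rw [two_mul]
    exact (edist_triangle_right _ _ x).trans (add_le_add
      (hi.edist_ergodicLimit_le_liminf x (hi.tendsto_ergodicLimit hω))
      (hα.edist_ergodicLimit_le_liminf x (hα.tendsto_ergodicLimit hω)))
  · rw [lintegral_const_mul' _ _ (by simp)]
    exact ENNReal.mul_ne_top (by simp) hfin.ne
  · filter_upwards [hc] with ω hω
    exact tendsto_iff_edist_tendsto_0.1 (tendsto_ergodicLimit_of_tendsto hκ hα hlim hω)

end ErgodicLimit

theorem corollary5p7 {M : Type*} [MetricSpace M] [MeasurableSpace M] [BorelSpace M] [Nonempty M]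
    (hM : IsGlobalNPC M)
    {Ω : Type*} [MeasurableSpace Ω] (P : Measure Ω) [IsProbabilityMeasure P]
    (T : Ω → Ω) (hT : MeasurePreserving T P P)
    (β : Measure M → M) (hβ : IsContractiveBarycentricMap β) :
    -- the objects in the claim are well defined: the geodesics, the map `λ`, the maps `β_t`
    ((∀ (x y : M) (γ : ℝ → M),
        IsMinimalGeodesic x y γ ↔ EqOn γ (geodesicPoint x y) (Icc 0 1)) ∧
      (IsContractiveBarycentricMap (canonicalBarycenter : Measure M → M) ∧
        ∀ μ ∈ P1 M, ∀ z : M, z = canonicalBarycenter μ ↔ IsCanonicalBarycenter μ z) ∧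
      (∀ t ∈ Ioc (0 : ℝ) 1, IsContractiveBarycentricMap (barycenterFlow t β) ∧
        ∀ μ ∈ P1 M, ∀ x : M, x = barycenterFlow t β μ ↔ x = β (geodesicPush x t μ))) ∧
    ∀ φ : Ω → M, MemL1 P φ →
      -- the ergodic limit functions exist, pointwise off one null set common to all `t`
      (IsErgodicLimit P T canonicalBarycenter φ (ergodicLimit T canonicalBarycenter φ) ∧
        (∀ t ∈ Ioc (0 : ℝ) 1,
          IsErgodicLimit P T (barycenterFlow t β) φ (ergodicLimit T (barycenterFlow t β) φ)) ∧
        ∀ᵐ ω ∂P, ∀ t ∈ Ioc (0 : ℝ) 1,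
          Tendsto (fun n : ℕ => barycenterFlow t β (empiricalMeasure T φ n ω)) atTop
            (𝓝 (ergodicLimit T (barycenterFlow t β) φ ω))) ∧
      -- convergence in `L¹` as `t → 0⁺`
      Tendsto (fun t : ℝ => distL1 P (ergodicLimit T (barycenterFlow t β) φ)
          (ergodicLimit T canonicalBarycenter φ)) (𝓝[>] 0) (𝓝 0) ∧
      -- convergence almost everywhere as `t → 0⁺`
      (∀ᵐ ω ∂P, Tendsto (fun t : ℝ => ergodicLimit T (barycenterFlow t β) φ ω) (𝓝[>] 0)
          (𝓝 (ergodicLimit T canonicalBarycenter φ ω))) ∧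
      -- convergence of the expectations if `T` is ergodic
      (Ergodic T P →
        Tendsto (fun t : ℝ => barycentricExpectation P (barycenterFlow t β) φ) (𝓝[>] 0)
          (𝓝 (barycentricExpectation P canonicalBarycenter φ))) := by

  have := hM.complete
  have hcan := hM.isContractiveBarycentricMap_canonicalBarycenter
  have hflow : ∀ t ∈ Ioc (0 : ℝ) 1, IsContractiveBarycentricMap (barycenterFlow t β) :=
    fun t ht => hM.isContractiveBarycentricMap_barycenterFlow hβ ht
  have hev : ∀ᶠ t in 𝓝[>] (0 : ℝ), IsContractiveBarycentricMap (barycenterFlow t β) :=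
    mem_of_superset (Ioc_mem_nhdsGT one_pos) hflow
  have hlim : ∀ μ ∈ P1 M, Tendsto (fun t : ℝ => barycenterFlow t β μ) (𝓝[>] 0)
      (𝓝 (canonicalBarycenter μ)) := fun μ hμ => hM.tendsto_barycenterFlow hβ hμ
  refine ⟨⟨hM.isMinimalGeodesic_iff, ⟨hcan, fun μ hμ z => hM.eq_canonicalBarycenter_iff hμ z⟩,
    fun t ht => ⟨hflow t ht, fun μ hμ x => hM.eq_barycenterFlow_iff hβ ht hμ x⟩⟩,
    fun φ hφ => ?_⟩
  have hc := ae_tendsto_contractiveDist hT hφ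
  refine ⟨⟨hcan.isErgodicLimit hT hφ, fun t ht => (hflow t ht).isErgodicLimit hT hφ, ?_⟩,
    tendsto_distL1_ergodicLimit_of_tendsto hev hcan hlim hT hφ, ?_,
    fun _ => hlim _ (map_mem_P1 hφ)⟩
  -- The null set is that of the `contractiveDist` Cauchy property, so `t` is introduced only after
  -- `ω` is fixed.
  · filter_upwards [hc] with ω hω t ht using (hflow t ht).tendsto_ergodicLimit hω
  · filter_upwards [hc] with ω hω using tendsto_ergodicLimit_of_tendsto hev hcan hlim hω
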